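/- Setting. Let $X$ be a connected, locally finite graph with vertex set $V$ and graph distance $\mathrm{dist}$. Let a group $\Gamma$ act on $X$ by graph automorphisms with finite vertex stabilizers, and let $F\subset V$ be a finite set meeting every $\Gamma$-orbit (so $X/\Gamma$ is finite). Suppose that $\Gamma$ is amenable, let $(I_L)_{L\in\mathbb N}$ be a Følner sequence of $\Gamma$ (finite non-empty sets such that for every finite non-empty $K\subset\Gamma$ and $\epsilon>0$ one has $|I_L\,\Delta\,KI_L|\le\epsilon|I_L|$ for all large $L$), and put $\Lambda_L=\bigcup_{\gamma\in I_L^{-1}}\gamma F$. Let $\mathbb P$ be a probability measure on $\Omega=[0,\infty]^V$ with the product $\sigma$-algebra, such that the shifts $(\tau_\gamma\omega)_k=\omega_{\gamma^{-1}k}$, $\gamma\in\Gamma$, preserve $\mathbb P$ and act ergodically. Let $R\in\mathbb N$ and let $H_0\colon V\times V\to\mathbb R$ be symmetric, $\Gamma$-invariant ($H_0(\gamma k,\gamma j)=H_0(k,j)$) and such that $H_0(k,j)=0$ whenever $\mathrm{dist}(k,j)\ge R$. For $\omega\in\Omega$ let $X(\omega)=\{k\in V:\omega_k<\infty\}$,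 and let $X^\infty(\omega)$ be the union of the infinite $H_0$-components of $X(\omega)$, i.e. of the infinite connected components of the graph on $X(\omega)$ in which distinct $k,j$ are adjacent iff $H_0(k,j)\ne 0$. Let $S(\omega)$ be either $X(\omega)$ for all $\omega$, or $X^\infty(\omega)$ for all $\omega$, and let $H_\omega$ be the operator in $\ell^2(S(\omega))$ given by $$(H_\omega f)(k)=\omega_kf(k)+\sum_{j\in S(\omega)}H_0(k,j)f(j),\qquad k\in S(\omega).$$ * Integrated density of states (IDS). Let $N_\omega^L(E)$ be $|\Lambda_L|^{-1}$ times the number of eigenvalues less than $E$, counted with multiplicity, of the restriction of $H_\omega$ to $\ell^2(\Lambda_L\cap S(\omega))$. The IDS is the distribution function $N$ such that, for almost every $\omega$, $\lim_{L\to\infty}N^L_\omega(E)=N(E)$ at all continuity points $E$ of $N$. * Unique continuation. The unique continuation property holds at $E\in\mathbb R$ if for every finite $\Lambda\subset V$, for almost every $\omega$ and every $f\in\ell^2(S(\omega))$ with $H_\omega f=Ef$: if $f$ vanishes on $\{k\in V\setminus\Lambda:\mathrm{dist}(k,\Lambda)\le 2R\}$, then $f$ vanishes on $\Lambda$. (Functions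 in $\ell^2(S(\omega))$ are extended by $0$ to $V$.) * $\Sigma_{\mathrm{fin}}$ is the set of $E\in\mathbb R$ such that, for almost every $\omega$, $E$ is an eigenvalue of $H_\omega$ that has an eigenfunction with finite support. Proposition. For each of the two families ($S=X$ and $S=X^\infty$) and every $E\in\mathbb R$, the following are equivalent: (i) the IDS of $\{H_\omega\}_\omega$ is discontinuous at $E$; (ii) the unique continuation property does not hold for $\{H_\omega\}_\omega$ at $E$; (iii) $E\in\Sigma_{\mathrm{fin}}$. (The equivalence of (ii) and (iii) is independent of the IDS; the equivalence with (i) is asserted for every non-decreasing $N$ with the stated convergence property.) -/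

import Mathlib

open MeasureTheory Filter Topology
open scoped ENNReal Pointwise symmDiff

namespace QuantumPercolation

noncomputable section

/-! ## The probability space of configurations -/

/-- The shift of configurations induced by the action of `Γ` on the vertices:
`(τ_γ ω)_k = ω_{γ⁻¹ k}`. -/
def shift {V Γ : Type*} [Group Γ] [MulAction Γ V] (γ : Γ) (ω : V → ℝ≥0∞) : V → ℝ≥0∞ :=
  fun k => ω (γ⁻¹ • k)

/-- The law `P` of the configuration `ω = (q_k)_{k ∈ V} ∈ [0,∞]^V` (with the product σ-algebra)
is invariant under all shifts, and the family of all shifts acts ergodically. -/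
structure IsErgodicField {V : Type*} (Γ : Type*) [Group Γ] [MulAction Γ V]
    (P : Measure (V → ℝ≥0∞)) : Prop where
  measurePreserving : ∀ γ : Γ, MeasurePreserving (shift (V := V) γ) P P
  ergodic : ∀ A : Set (V → ℝ≥0∞), MeasurableSet A → (∀ γ : Γ, shift γ ⁻¹' A = A) →
    P A = 0 ∨ P A = 1

/-! ## Amenability and exhaustions -/

open Classical in
/-- A Følner sequence of finite non-empty subsets of the group `Γ`: for all finite non-empty `K` and
`ε > 0` one has `|I_L ∆ K I_L| ≤ ε |I_L|` for all large `L`. -/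
structure IsFolnerSequence {Γ : Type*} [Group Γ] (I : ℕ → Finset Γ) : Prop where
  nonempty : ∀ L, (I L).Nonempty
  folner : ∀ K : Finset Γ, K.Nonempty → ∀ ε : ℝ, 0 < ε →
    ∀ᶠ L in atTop, (((I L) ∆ (K * I L)).card : ℝ) ≤ ε * ((I L).card : ℝ)

open Classical in
/-- The finite set of vertices `Λ_L = ⋃_{γ ∈ I_L⁻¹} γ F`. -/
def exhaustion {V Γ : Type*} [Group Γ] [MulAction Γ V] (F : Finset V) (I : ℕ → Finset Γ)
    (L : ℕ) : Finset V :=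
  (I L)⁻¹ • F

/-! ## The random Hamiltonian -/

/-- A finite hopping range operator on the graph `G`, given by its matrix elements `H₀(k,j)`:
real and symmetric, `Γ`-invariant, and vanishing at distance at least `R`. -/
structure HoppingOperator {V : Type*} (G : SimpleGraph V) (Γ : Type*) [Group Γ] [MulAction Γ V]
    (R : ℕ) where
  kernel : V → V → ℝ
  symm : ∀ k j, kernel k j = kernel j k
  invariant : ∀ (γ : Γ) (k j : V), kernel (γ • k) (γ • j) = kernel k j
  range : ∀ k j, R ≤ G.dist k j → kernel k j = 0

/-- The set `X(ω)` of active sites. -/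
def activeSites {V : Type*} (ω : V → ℝ≥0∞) : Set V := {k | ω k < ∞}

/-- `H₀`-path connectedness inside the set `S`: `j` can be reached from `k` by a finite sequence of
vertices of `S` in which the matrix elements between consecutive vertices are non-zero. -/
def PathConnectedIn {V : Type*} (H : V → V → ℝ) (S : Set V) : V → V → Prop :=
  Relation.ReflTransGen fun k j => k ∈ S ∧ j ∈ S ∧ H k j ≠ 0

/-- The set `X^∞(ω)`: the union of the infinite `H₀`-components of `X(ω)`. -/
def infiniteCluster {V : Type*} (H : V → V → ℝ) (ω : V → ℝ≥0∞) : Set V :=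
  {k | k ∈ activeSites ω ∧ {j | PathConnectedIn H (activeSites ω) k j}.Infinite}

/-- The Hamiltonian with potential `ω` on the set `S ⊆ X(ω)`:
`(H f)(k) = ω_k f(k) + ∑_{j ∈ S} H₀(k,j) f(j)` for `k ∈ S` (extended by `0` off `S`).
For a hopping operator on a locally finite connected graph the sum has finitely many non-zero
terms. -/
def hamiltonian {V : Type*} (H : V → V → ℝ) (ω : V → ℝ≥0∞) (S : Set V) (f : V → ℂ) : V → ℂ :=
  S.indicator fun k => ((ω k).toReal : ℂ) * f k + ∑ᶠ j ∈ S, (H k j : ℂ) * f j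

/-- `f ∈ ℓ²(S)` (the square-summable functions on `V` that vanish off `S`) solves `H f = E f`.
A function in `ℓ²(S)` that solves this equation pointwise satisfies `ω f ∈ ℓ²(S)`, since `H₀` is
bounded; so it lies in the maximal domain of the (possibly unbounded) operator. -/
def IsSolution {V : Type*} (H : V → V → ℝ) (ω : V → ℝ≥0∞) (S : Set V) (E : ℝ)
    (f : lp (fun _ : V => ℂ) 2) : Prop :=
  (∀ k, k ∉ S → f k = 0) ∧ ∀ k, hamiltonian H ω S (fun j => f j) k = (E : ℂ) * f k

/-- `σ_fin` of the Hamiltonian on `S`: the eigenvalues that possess an eigenfunction with finite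
support. -/
def sigmaFin {V : Type*} (H : V → V → ℝ) (ω : V → ℝ≥0∞) (S : Set V) : Set ℝ :=
  {E | ∃ f : lp (fun _ : V => ℂ) 2, f ≠ 0 ∧ {k | f k ≠ 0}.Finite ∧ IsSolution H ω S E f}

/-- The almost sure set `Σ_fin` of the family of Hamiltonians on the random sets `S ω`: the energies
that belong to `σ_fin` for almost every configuration. -/
def almostSureSigmaFin {V : Type*} (H : V → V → ℝ) (P : Measure (V → ℝ≥0∞))
    (S : (V → ℝ≥0∞) → Set V) : Set ℝ :=
  {E | ∀ᵐ ω ∂P, E ∈ sigmaFin H ω (S ω)}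

/-! ## Unique continuation -/

/-- The outer `l`-boundary of `Λ`: the vertices outside `Λ` at distance at most `l` from `Λ`. -/
def outerBoundary {V : Type*} (G : SimpleGraph V) (l : ℕ) (Λ : Finset V) : Set V :=
  {k | k ∉ Λ ∧ ∃ j ∈ Λ, G.dist k j ≤ l}

/-- The unique continuation property at the energy `E` for the family of Hamiltonians on the random
sets `S ω`. -/
def UniqueContinuation {V : Type*} (G : SimpleGraph V) (R : ℕ) (H : V → V → ℝ)
    (P : Measure (V → ℝ≥0∞)) (S : (V → ℝ≥0∞) → Set V) (E : ℝ) : Prop :=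
  ∀ Λ : Finset V, ∀ᵐ ω ∂P, ∀ f : lp (fun _ : V => ℂ) 2,
    IsSolution H ω (S ω) E f → (∀ k ∈ outerBoundary G (2 * R) Λ, f k = 0) → ∀ k ∈ Λ, f k = 0

/-! ## The integrated density of states -/

open Classical in
/-- The matrix of the restriction of the Hamiltonian to a finite set of sites. -/
def restrictedMatrix {V : Type*} (H : V → V → ℝ) (ω : V → ℝ≥0∞) (B : Finset V) : Matrix B B ℝ :=
  Matrix.diagonal (fun k : B => (ω k).toReal) + Matrix.of fun k j : B => H k j

open Classical in
theorem isHermitian_restrictedMatrix {V : Type*} {H : V → V → ℝ} (hH : ∀ k j, H k j = H j k)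
    (ω : V → ℝ≥0∞) (B : Finset V) : (restrictedMatrix H ω B).IsHermitian := by
  unfold restrictedMatrix
  refine Matrix.IsHermitian.add ?_ ?_
  · exact Matrix.isHermitian_diagonal _
  · ext k j
    simp [Matrix.conjTranspose_apply, hH k j]

open Classical in
/-- The normalised eigenvalue counting function of the restriction of the Hamiltonian to `Λ ∩ S`:
the number of eigenvalues less than `E`, with multiplicities, divided by `|Λ|`. -/
def countingFunction {V : Type*} {H : V → V → ℝ} (hH : ∀ k j, H k j = H j k) (ω : V → ℝ≥0∞)
    (S : Set V) (Λ : Finset V) (E : ℝ) : ℝ :=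
  ((Finset.univ.filter fun i =>
    (isHermitian_restrictedMatrix hH ω (Λ.filter (· ∈ S))).eigenvalues i < E).card : ℝ) /
      (Λ.card : ℝ)

/-- `N` is the integrated density of states of the family of Hamiltonians on the random sets `S ω`
along the exhaustion `Λ`: it is non-decreasing, and for almost every configuration the normalised
eigenvalue counting functions converge to it at all its continuity points. (The points of
discontinuity of such a function do not depend on its one-sided continuity.) -/
structure IsIDS {V : Type*} {H : V → V → ℝ} (hH : ∀ k j, H k j = H j k)
    (P : Measure (V → ℝ≥0∞)) (S : (V → ℝ≥0∞) → Set V) (Λ : ℕ → Finset V) (N : ℝ → ℝ) : Prop where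
  monotone : Monotone N
  tendsto : ∀ᵐ ω ∂P, ∀ E : ℝ, ContinuousAt N E →
    Tendsto (fun L => countingFunction hH ω (S ω) (Λ L) E) atTop (𝓝 (N E))

end

end QuantumPercolation

open QuantumPercolation

namespace QuantumPercolation

/-! ## Finite-dimensional linear algebra -/

/-! Unique continuation fails exactly when finitely supported eigenfunctions occur. A solution that
vanishes on a collar of width `2 * R` around `Λ`, but not on `Λ`, stays a solution when cut off to
`Λ` (`mem_sigmaFin_of_vanishing`). Conversely, the support of a finitely supported eigenfunction is
a set on which continuation fails. Ergodicity turns "with positive probability" into "almost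
surely".

Finitely supported eigenfunctions force a jump of the IDS. Some finite `B` supports an eigenfunction
with probability `p > 0`. Every translate of `B` in the box that supports one carries at least unit
mass of the eigenspace at `E`, and translates overlap boundedly often, so the multiplicity of `E`
bounds the number of such translates (`exists_card_eigenfunctions_le`). If `N` were continuous at
`E`, this number would be too small a fraction of the box for the probability `p`.

A jump forces finitely supported eigenfunctions. Without them, `H - E` is injective on functions
supported in a fixed box `B`, hence bounded below with a constant `s` outside an event of small
probability. On a translate of `B` where the bound holds, a combination of eigenvectors with
energies near `E` that vanishes on the collar of `B` is almost annihilated by `H - E`, hence small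
on `B`. By a trace estimate the eigenvectors near `E` then have mass there at most the collar size
plus a small error (`sum_siteEigenvector_translate_sq_le`). Følner boxes have small collars, so a
positive density of eigenvalues near `E` would require too many translates without the bound
(`exists_card_eigenvalues_le`).

Frequencies along the box are compared with probabilities by Fatou's lemma and invariance
(`le_measure_of_eventually_le_card`), so no pointwise ergodic theorem is needed. -/

theorem sq_norm_eq_sum_inner_add_sum_inner {K : Type*} [NormedAddCommGroup K]
    [InnerProductSpace ℝ K] [FiniteDimensional ℝ K] (U : Submodule ℝ K) (x : K) :
    ‖x‖ ^ 2 = ∑ i, (inner ℝ x (stdOrthonormalBasis ℝ U i : K)) ^ 2 +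
      ∑ i, (inner ℝ x (stdOrthonormalBasis ℝ Uᗮ i : K)) ^ 2 := by
  have key : ∀ W : Submodule ℝ K, ‖W.orthogonalProjectionOnto x‖ ^ 2 =
      ∑ i, (inner ℝ x (stdOrthonormalBasis ℝ W i : K)) ^ 2 := fun W => by
    rw [← (stdOrthonormalBasis ℝ W).sum_sq_norm_inner_right]
    refine Finset.sum_congr rfl fun i _ => ?_
    rw [Real.norm_eq_abs, sq_abs, real_inner_comm,
      Submodule.inner_orthogonalProjectionOnto_eq_of_mem_right]
  rw [Submodule.norm_sq_eq_add_norm_sq_projection x U, key, key]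

/-- If a quadratic form bounded by the norm is controlled by a second one on the annihilator of
`D.card` vectors, then its trace is at most `D.card` plus the corresponding multiple of the trace of
the second form. -/
theorem sum_sq_norm_le_card_add {K α β δ : Type*} [NormedAddCommGroup K]
    [InnerProductSpace ℝ K] [FiniteDimensional ℝ K] (A : Finset α) (a : α → K)
    (B : Finset β) (b : β → K) (D : Finset δ) (d : δ → K) {s : ℝ} (hs : 0 < s)
    (hcontr : ∀ c, ∑ k ∈ A, (inner ℝ (a k) c) ^ 2 ≤ ‖c‖ ^ 2)
    (hcoer : ∀ c, (∀ k ∈ D, inner ℝ (d k) c = 0) →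
      s * ∑ k ∈ A, (inner ℝ (a k) c) ^ 2 ≤ ∑ k ∈ B, (inner ℝ (b k) c) ^ 2) :
    ∑ k ∈ A, ‖a k‖ ^ 2 ≤ D.card + s⁻¹ * ∑ k ∈ B, ‖b k‖ ^ 2 := by
  classical
  set U : Submodule ℝ K := Submodule.span ℝ (D.image d : Set K) with hU
  have hdim : Module.finrank ℝ U ≤ D.card :=
    (finrank_span_finset_le_card _).trans Finset.card_image_le
  -- Both traces are computed in an orthonormal basis adapted to `U` and its complement. Each of the
  -- at most `D.card` basis vectors of `U` contributes at most 1 by `hcontr`; on the complement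
  -- `hcoer` applies.
  simp_rw [sq_norm_eq_sum_inner_add_sum_inner U, Finset.sum_add_distrib]
  rw [Finset.sum_comm, Finset.sum_comm (s := A) (t := Finset.univ)]
  refine add_le_add ?_ ?_
  · calc _ ≤ ∑ i : Fin (Module.finrank ℝ U), (1 : ℝ) := Finset.sum_le_sum fun i _ => by
          refine (hcontr _).trans ?_
          rw [← Submodule.coe_norm, (stdOrthonormalBasis ℝ U).orthonormal.1 i]; norm_num
      _ ≤ D.card := by simpa using hdim
  · rw [mul_add, Finset.sum_comm (s := B) (t := Finset.univ),
      Finset.sum_comm (s := B) (t := Finset.univ)]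
    refine le_add_of_nonneg_of_le (by positivity) ?_
    rw [Finset.mul_sum]
    refine Finset.sum_le_sum fun i _ => ?_
    rw [le_inv_mul_iff₀ hs]
    refine hcoer _ fun k hk => ?_
    exact (stdOrthonormalBasis ℝ Uᗮ i).2 _ (Submodule.subset_span (by
      simpa using ⟨k, hk, rfl⟩))

/-! ## Locally finite graphs and finite hopping range -/

theorem finite_dist_le {V : Type*} (G : SimpleGraph V) (hconn : G.Connected)
    (hlf : ∀ v, (G.neighborSet v).Finite) (v : V) (n : ℕ) : {w | G.dist v w ≤ n}.Finite := by
  induction n with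
  | zero =>
    refine (Set.finite_singleton v).subset fun w hw => ?_
    have := hconn.dist_eq_zero_iff.1 (Nat.le_zero.1 hw)
    simp [this]
  | succ n ih =>
    refine (ih.union (ih.biUnion fun w _ => hlf w)).subset fun w hw => ?_
    rcases Nat.lt_or_ge n (G.dist v w) with hlt | hle
    · have hd : G.dist v w = n + 1 := le_antisymm hw hlt
      obtain ⟨p, hp⟩ := hconn.exists_walk_length_eq_dist w v
      rw [SimpleGraph.dist_comm, hd] at hp
      cases p with
      | nil => simp at hp
      | cons hadj q =>
        rename_i u
        right
        simp only [Set.mem_iUnion]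
        refine ⟨u, ?_, hadj.symm⟩
        have := SimpleGraph.dist_le q
        rw [SimpleGraph.dist_comm] at this
        simp only [SimpleGraph.Walk.length_cons] at hp
        exact this.trans (by omega)
    · exact Or.inl hle

theorem countable_of_connected {V : Type*} (G : SimpleGraph V) (hconn : G.Connected)
    (hlf : ∀ v, (G.neighborSet v).Finite) : Countable V := by
  obtain ⟨v⟩ := hconn.nonempty
  rw [← Set.countable_univ_iff]
  refine (Set.countable_iUnion fun n => (finite_dist_le G hconn hlf v n).countable).mono
    fun w _ => Set.mem_iUnion.2 ⟨G.dist v w, le_refl (G.dist v w)⟩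

theorem HoppingOperator.finite_row {V Γ : Type*} {G : SimpleGraph V} (hconn : G.Connected)
    (hlf : ∀ v, (G.neighborSet v).Finite) [Group Γ] [MulAction Γ V] {R : ℕ}
    (H : HoppingOperator G Γ R) (k : V) : {j | H.kernel k j ≠ 0}.Finite := by
  refine (finite_dist_le G hconn hlf k R).subset fun j hj => ?_
  by_contra hlt
  exact hj (H.range k j (not_le.1 hlt).le)

open Classical in
/-- A finite set of sites together with the sites that are coupled to it. -/
noncomputable def hoppingNbhd {V : Type*} {h : V → V → ℝ} (hfin : ∀ k, {j | h k j ≠ 0}.Finite)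
    (B : Finset V) : Finset V :=
  B ∪ B.biUnion fun k => (hfin k).toFinset

section Nbhd

variable {V : Type*} {h : V → V → ℝ} (hfin : ∀ k, {j | h k j ≠ 0}.Finite)

theorem mem_hoppingNbhd {B : Finset V} {k : V} :
    k ∈ hoppingNbhd hfin B ↔ k ∈ B ∨ ∃ j ∈ B, h j k ≠ 0 := by
  simp [hoppingNbhd]

theorem subset_hoppingNbhd (B : Finset V) : B ⊆ hoppingNbhd hfin B := fun _ hk =>
  (mem_hoppingNbhd hfin).2 (Or.inl hk)

theorem smul_mem_hoppingNbhd {Γ : Type*} [Group Γ] [MulAction Γ V]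
    (hinv : ∀ (γ : Γ) k j, h (γ • k) (γ • j) = h k j) {B C : Finset V} (γ : Γ)
    (hBC : ∀ k ∈ B, γ • k ∈ C) {k : V} (hk : k ∈ hoppingNbhd hfin B) :
    γ • k ∈ hoppingNbhd hfin C := by
  rw [mem_hoppingNbhd] at hk ⊢
  rcases hk with hk | ⟨j, hj, hjk⟩
  · exact Or.inl (hBC k hk)
  · exact Or.inr ⟨γ • j, hBC j hj, by rwa [hinv]⟩

theorem hoppingNbhd_smul_subset {Γ : Type*} [Group Γ] [MulAction Γ V] [DecidableEq V]
    (hinv : ∀ (γ : Γ) k j, h (γ • k) (γ • j) = h k j) (I : Finset Γ) (B : Finset V) :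
    hoppingNbhd hfin (I • B) ⊆ I • hoppingNbhd hfin B := by
  intro k hk
  rw [mem_hoppingNbhd] at hk
  rcases hk with hk | ⟨j, hj, hjk⟩
  · exact Finset.smul_subset_smul_left (subset_hoppingNbhd hfin B) hk
  · obtain ⟨γ, hγ, b, hb, rfl⟩ := Finset.mem_smul.1 hj
    refine Finset.mem_smul.2 ⟨γ, hγ, γ⁻¹ • k, ?_, smul_inv_smul _ _⟩
    refine (mem_hoppingNbhd hfin).2 (Or.inr ⟨b, hb, ?_⟩)
    rwa [← hinv γ, smul_inv_smul]

end Nbhd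

/-! ## The Hamiltonian on real functions -/

/-- The formal operator `(H f)(k) = ω_k f(k) + ∑_j H₀(k,j) f(j)` on real functions. -/
noncomputable def energyOp {V : Type*} (h : V → V → ℝ) (ω : V → ℝ≥0∞) (f : V → ℝ) (k : V) : ℝ :=
  (ω k).toReal * f k + ∑ᶠ j, h k j * f j

/-- There is a non-zero real eigenfunction at the energy `E` that is supported in `B`. -/
def HasEigenfunctionOn {V : Type*} (h : V → V → ℝ) (ω : V → ℝ≥0∞) (S : Set V) (E : ℝ)
    (B : Finset V) : Prop :=
  ∃ f : V → ℝ, (∃ k, f k ≠ 0) ∧ (∀ k, f k ≠ 0 → k ∈ B ∧ k ∈ S) ∧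
    ∀ k ∈ S, energyOp h ω f k = E * f k

section EnergyOp

variable {V : Type*} {h : V → V → ℝ}

theorem energyOp_eq_sum {ω : V → ℝ≥0∞} {f : V → ℝ} {k : V} (T : Finset V)
    (hT : ∀ j, h k j ≠ 0 → f j ≠ 0 → j ∈ T) :
    energyOp h ω f k = (ω k).toReal * f k + ∑ j ∈ T, h k j * f j := by
  rw [energyOp, finsum_eq_sum_of_support_subset]
  intro j hj
  simp only [Function.mem_support, ne_eq, mul_eq_zero, not_or] at hj
  exact hT j hj.1 hj.2

theorem energyOp_congr {ω : V → ℝ≥0∞} {f g : V → ℝ} {k : V} (hk : f k = g k)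
    (hfg : ∀ j, h k j ≠ 0 → f j = g j) : energyOp h ω f k = energyOp h ω g k := by
  rw [energyOp, energyOp, hk]
  congr 1
  refine finsum_congr fun j => ?_
  by_cases hj : h k j = 0
  · simp [hj]
  · rw [hfg j hj]

theorem energyOp_sum (hfin : ∀ k, {j | h k j ≠ 0}.Finite) {ι : Type*} (T : Finset ι) (c : ι → ℝ)
    (u : ι → V → ℝ) (ω : V → ℝ≥0∞) (k : V) :
    energyOp h ω (fun j => ∑ i ∈ T, c i * u i j) k = ∑ i ∈ T, c i * energyOp h ω (u i) k := by
  have hmem : ∀ (f : V → ℝ) j, h k j ≠ 0 → f j ≠ 0 → j ∈ (hfin k).toFinset := by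
    intro f j hj _
    simpa using hj
  simp_rw [energyOp_eq_sum (hfin k).toFinset (hmem _), mul_add, Finset.sum_add_distrib,
    Finset.mul_sum]
  rw [Finset.sum_comm (s := T)]
  congr 1
  · exact Finset.sum_congr rfl fun i _ => by ring
  · exact Finset.sum_congr rfl fun j _ => Finset.sum_congr rfl fun i _ => by ring

theorem energyOp_shift {Γ : Type*} [Group Γ] [MulAction Γ V]
    (hinv : ∀ (γ : Γ) k j, h (γ • k) (γ • j) = h k j) (γ : Γ) (ω : V → ℝ≥0∞) (f : V → ℝ) (k : V) :
    energyOp h (shift γ ω) f k = energyOp h ω (fun j => f (γ • j)) (γ⁻¹ • k) := by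
  simp only [energyOp, shift, smul_inv_smul]
  congr 1
  rw [← finsum_comp_equiv (MulAction.toPerm γ)]
  refine finsum_congr fun j => ?_
  simp only [MulAction.toPerm_apply]
  rw [← hinv γ (γ⁻¹ • k) j, smul_inv_smul]

theorem hamiltonian_apply (hfin : ∀ k, {j | h k j ≠ 0}.Finite) {ω : V → ℝ≥0∞} {S : Set V}
    {f : V → ℂ} (hf : ∀ k, k ∉ S → f k = 0) {k : V} (hk : k ∈ S) :
    hamiltonian h ω S f k =
      ((ω k).toReal : ℂ) * f k + ∑ j ∈ (hfin k).toFinset, (h k j : ℂ) * f j := by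
  rw [hamiltonian, Set.indicator_of_mem hk]
  congr 1
  have : ∀ j, (∑ᶠ (_ : j ∈ S), (h k j : ℂ) * f j) = (h k j : ℂ) * f j := by
    intro j
    by_cases hj : j ∈ S
    · simp [hj]
    · simp [hf j hj]
  simp_rw [this]
  refine finsum_eq_sum_of_support_subset _ fun j hj => ?_
  simp only [Function.mem_support, ne_eq, mul_eq_zero, not_or] at hj
  simpa using hj.1

theorem isSolution_iff (hfin : ∀ k, {j | h k j ≠ 0}.Finite) {ω : V → ℝ≥0∞} {S : Set V} {E : ℝ}
    {f : lp (fun _ : V => ℂ) 2} :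
    IsSolution h ω S E f ↔ (∀ k, k ∉ S → f k = 0) ∧ ∀ k ∈ S,
      ((ω k).toReal : ℂ) * f k + ∑ j ∈ (hfin k).toFinset, (h k j : ℂ) * f j = (E : ℂ) * f k := by
  refine and_congr_right fun hf => ⟨fun hs k hk => ?_, fun hs k => ?_⟩
  · rw [← hamiltonian_apply hfin (f := fun j => f j) hf hk, hs k]
  · by_cases hk : k ∈ S
    · rw [hamiltonian_apply hfin (f := fun j => f j) hf hk, hs k hk]
    · rw [hamiltonian, Set.indicator_of_notMem hk, hf k hk, mul_zero]

theorem mem_sigmaFin_of_function (hfin : ∀ k, {j | h k j ≠ 0}.Finite) {ω : V → ℝ≥0∞} {S : Set V}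
    {E : ℝ} {f : V → ℂ} (hne : ∃ k, f k ≠ 0) (hsupp : {k | f k ≠ 0}.Finite)
    (hS : ∀ k, k ∉ S → f k = 0)
    (heq : ∀ k ∈ S, ((ω k).toReal : ℂ) * f k + ∑ j ∈ (hfin k).toFinset, (h k j : ℂ) * f j =
      (E : ℂ) * f k) : E ∈ sigmaFin h ω S := by
  have hmem : Memℓp (E := fun _ : V => ℂ) f 2 :=
    (memℓp_zero (E := fun _ : V => ℂ) hsupp).of_exponent_ge (by simp)
  refine ⟨⟨f, hmem⟩, ?_, hsupp, (isSolution_iff hfin).2 ⟨hS, heq⟩⟩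
  intro h0
  obtain ⟨k, hk⟩ := hne
  exact hk (congrFun (congrArg Subtype.val h0) k)

/-- The kernel, the potential and `E` are real, so the real and imaginary parts of a complex
solution are solutions, and one of them is non-zero. -/
theorem mem_sigmaFin_iff (hfin : ∀ k, {j | h k j ≠ 0}.Finite) {ω : V → ℝ≥0∞} {S : Set V} {E : ℝ} :
    E ∈ sigmaFin h ω S ↔ ∃ B : Finset V, HasEigenfunctionOn h ω S E B := by
  have hmem : ∀ (k : V) (f : V → ℝ) j, h k j ≠ 0 → f j ≠ 0 → j ∈ (hfin k).toFinset := by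
    intro k f j hj _
    simpa using hj
  constructor
  · rintro ⟨f, hf0, hfs, hsol⟩
    obtain ⟨hS, heq⟩ := (isSolution_iff hfin).1 hsol
    obtain ⟨k₀, hk₀⟩ : ∃ k, f k ≠ 0 := by
      by_contra! hall
      exact hf0 (lp.ext (funext hall))
    have hre : ∀ k ∈ S, energyOp h ω (fun j => (f j).re) k = E * (f k).re := fun k hk => by
      have := congrArg Complex.re (heq k hk)
      rw [energyOp_eq_sum _ (hmem k _)]
      simpa using this
    have him : ∀ k ∈ S, energyOp h ω (fun j => (f j).im) k = E * (f k).im := fun k hk => by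
      have := congrArg Complex.im (heq k hk)
      rw [energyOp_eq_sum _ (hmem k _)]
      simpa using this
    have hsupp : ∀ k, f k ≠ 0 → k ∈ hfs.toFinset ∧ k ∈ S := fun k hk =>
      ⟨by simpa using hk, by_contra fun hkS => hk (hS k hkS)⟩
    by_cases h0 : (f k₀).re = 0
    · refine ⟨hfs.toFinset, fun j => (f j).im, ⟨k₀, fun h1 => hk₀ (Complex.ext h0 h1)⟩,
        fun k hk => hsupp k fun h2 => hk (by simp [h2]), him⟩
    · exact ⟨hfs.toFinset, fun j => (f j).re, ⟨k₀, h0⟩,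
        fun k hk => hsupp k fun h2 => hk (by simp [h2]), hre⟩
  · rintro ⟨B, f, ⟨k₀, hk₀⟩, hsupp, heq⟩
    refine mem_sigmaFin_of_function hfin (f := fun k => (f k : ℂ)) ⟨k₀, by exact_mod_cast hk₀⟩
      (B.finite_toSet.subset fun k hk => (hsupp k (by simpa using hk)).1) (fun k hk => ?_)
      fun k hk => ?_
    · by_contra h0
      exact hk (hsupp k (by simpa using h0)).2
    · have := heq k hk
      rw [energyOp_eq_sum _ (hmem k _)] at this
      exact_mod_cast this

/-- Truncating a solution that vanishes on a sufficiently large collar of a finite set yields an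
eigenfunction with finite support. -/
theorem mem_sigmaFin_of_vanishing (G : SimpleGraph V) (hconn : G.Connected) {R : ℕ}
    (hfin : ∀ k, {j | h k j ≠ 0}.Finite) (hrange : ∀ k j, R ≤ G.dist k j → h k j = 0)
    {ω : V → ℝ≥0∞} {S : Set V} {E : ℝ}
    {Λ : Finset V} {f : lp (fun _ : V => ℂ) 2} (hsol : IsSolution h ω S E f)
    (hbd : ∀ k ∈ outerBoundary G (2 * R) Λ, f k = 0) (hne : ∃ k ∈ Λ, f k ≠ 0) :
    E ∈ sigmaFin h ω S := by
  classical
  obtain ⟨hS, heq⟩ := (isSolution_iff hfin).1 hsol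
  have hlt : ∀ k j, h k j ≠ 0 → G.dist k j < R := fun k j hkj =>
    not_le.1 fun hle => hkj (hrange k j hle)
  obtain ⟨k₀, hk₀Λ, hk₀⟩ := hne
  refine mem_sigmaFin_of_function hfin (f := fun k => if k ∈ Λ then f k else 0)
    ⟨k₀, by simpa [hk₀Λ] using hk₀⟩
    (Λ.finite_toSet.subset fun k hk => by by_contra hkΛ; exact hk (if_neg hkΛ))
    (fun k hk => by simp [hS k hk]) fun k hk => ?_
  by_cases hkΛ : k ∈ Λ
  · rw [if_pos hkΛ, ← heq k hk]
    congr 1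
    refine Finset.sum_congr rfl fun j hj => ?_
    by_cases hjΛ : j ∈ Λ
    · rw [if_pos hjΛ]
    · rw [if_neg hjΛ, hbd j ⟨hjΛ, k, hkΛ, ?_⟩]
      have := hlt k j (by simpa using hj)
      rw [SimpleGraph.dist_comm]
      omega
  · rw [if_neg hkΛ, mul_zero, mul_zero, zero_add]
    -- A site outside `Λ` coupled to some `i ∈ Λ` lies in the collar, and its couplings outside `Λ`
    -- lie within `2 * R` of `i`. There `f` vanishes, so the truncated equation at `k` is the
    -- original one.
    by_cases hnb : ∃ i ∈ Λ, h k i ≠ 0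
    · obtain ⟨i, hiΛ, hki⟩ := hnb
      have hki := hlt k i hki
      have hfk : f k = 0 := hbd k ⟨hkΛ, i, hiΛ, by omega⟩
      have := heq k hk
      rw [hfk, mul_zero, mul_zero, zero_add] at this
      refine Eq.trans (Finset.sum_congr rfl fun j hj => ?_) this
      by_cases hjΛ : j ∈ Λ
      · rw [if_pos hjΛ]
      · rw [if_neg hjΛ, hbd j ⟨hjΛ, i, hiΛ, ?_⟩]
        have hkj := hlt k j (by simpa using hj)
        have := hconn.dist_triangle (u := j) (v := k) (w := i)
        rw [SimpleGraph.dist_comm] at hkj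
        omega
    · push Not at hnb
      refine Finset.sum_eq_zero fun j hj => ?_
      by_cases hjΛ : j ∈ Λ
      · simp [hnb j hjΛ]
      · simp [hjΛ]

end EnergyOp

/-! ## Random sets of sites -/

/-- A random set of sites that is measurable and equivariant under the shifts. -/
structure IsSiteField {V : Type*} (Γ : Type*) [Group Γ] [MulAction Γ V]
    (S : (V → ℝ≥0∞) → Set V) : Prop where
  mem_shift : ∀ (γ : Γ) ω k, k ∈ S (shift γ ω) ↔ γ⁻¹ • k ∈ S ω
  measurableSet_mem : ∀ k, MeasurableSet {ω | k ∈ S ω}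

theorem isSiteField_activeSites {V : Type*} (Γ : Type*) [Group Γ] [MulAction Γ V] :
    IsSiteField Γ (activeSites (V := V)) where
  mem_shift _ _ _ := Iff.rfl
  measurableSet_mem k := measurableSet_lt (measurable_pi_apply k) measurable_const

theorem shift_inv_shift {V Γ : Type*} [Group Γ] [MulAction Γ V] (γ : Γ) (ω : V → ℝ≥0∞) :
    shift γ⁻¹ (shift γ ω) = ω := by
  funext k
  simp [shift]

/-- Reachability in exactly `n` steps of a relation. -/
def ReachableInSteps {V : Type*} (r : V → V → Prop) : ℕ → V → V → Prop
  | 0, k, j => k = j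
  | n + 1, k, j => ∃ i, ReachableInSteps r n k i ∧ r i j

theorem reflTransGen_iff_exists_reachableInSteps {V : Type*} (r : V → V → Prop) (k j : V) :
    Relation.ReflTransGen r k j ↔ ∃ n, ReachableInSteps r n k j := by
  constructor
  · intro hkj
    induction hkj with
    | refl => exact ⟨0, rfl⟩
    | tail _ hij ih =>
      obtain ⟨n, hn⟩ := ih
      exact ⟨n + 1, _, hn, hij⟩
  · rintro ⟨n, hn⟩
    induction n generalizing j with
    | zero => exact hn ▸ Relation.ReflTransGen.refl
    | succ n ih =>
      obtain ⟨i, hi, hij⟩ := hn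
      exact (ih i hi).tail hij

theorem measurableSet_pathConnectedIn {V : Type*} [Countable V] (h : V → V → ℝ) (k j : V) :
    MeasurableSet {ω : V → ℝ≥0∞ | PathConnectedIn h (activeSites ω) k j} := by
  have hmem : ∀ i : V, MeasurableSet {ω : V → ℝ≥0∞ | i ∈ activeSites ω} := fun i =>
    (isSiteField_activeSites (V := V) (Equiv.Perm V)).measurableSet_mem i
  simp only [PathConnectedIn, reflTransGen_iff_exists_reachableInSteps, Set.ofPred_exists]
  refine MeasurableSet.iUnion fun n => ?_
  induction n generalizing j with
  | zero => exact MeasurableSet.const _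
  | succ n ih =>
    simp only [ReachableInSteps, Set.ofPred_exists]
    exact MeasurableSet.iUnion fun i =>
      (ih i).inter ((hmem i).inter ((hmem j).inter (MeasurableSet.const _)))

theorem pathConnectedIn_shift {V Γ : Type*} [Group Γ] [MulAction Γ V] {h : V → V → ℝ}
    (hinv : ∀ (γ : Γ) k j, h (γ • k) (γ • j) = h k j) (γ : Γ) {ω : V → ℝ≥0∞} {k j : V}
    (hkj : PathConnectedIn h (activeSites ω) k j) :
    PathConnectedIn h (activeSites (shift γ ω)) (γ • k) (γ • j) := by
  refine Relation.ReflTransGen.lift (fun v => γ • v) (fun a b hab => ?_) _ _ hkj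
  refine ⟨?_, ?_, by rw [hinv]; exact hab.2.2⟩
  · have := hab.1
    simpa [activeSites, shift] using this
  · have := hab.2.1
    simpa [activeSites, shift] using this

theorem smul_mem_infiniteCluster_shift {V Γ : Type*} [Group Γ] [MulAction Γ V] {h : V → V → ℝ}
    (hinv : ∀ (γ : Γ) k j, h (γ • k) (γ • j) = h k j) (γ : Γ) {ω : V → ℝ≥0∞} {k : V}
    (hk : k ∈ infiniteCluster h ω) : γ • k ∈ infiniteCluster h (shift γ ω) := by
  refine ⟨?_, ?_⟩
  · have := hk.1
    simpa [activeSites, shift] using this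
  · refine (hk.2.image (MulAction.injective γ).injOn).mono ?_
    rintro _ ⟨j, hj, rfl⟩
    exact pathConnectedIn_shift hinv γ hj

theorem isSiteField_infiniteCluster {V Γ : Type*} [Countable V] [Group Γ] [MulAction Γ V]
    {h : V → V → ℝ} (hinv : ∀ (γ : Γ) k j, h (γ • k) (γ • j) = h k j) :
    IsSiteField Γ (infiniteCluster h) where
  mem_shift γ ω k := by
    constructor
    · intro hk
      have := smul_mem_infiniteCluster_shift hinv γ⁻¹ hk
      rwa [shift_inv_shift] at this
    · intro hk
      have := smul_mem_infiniteCluster_shift hinv γ hk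
      rwa [smul_inv_smul] at this
  measurableSet_mem k := by
    -- A cluster is infinite iff it leaves every finite set, which uses only countably many
    -- conditions.
    have : {ω | k ∈ infiniteCluster h ω} = {ω | k ∈ activeSites ω} ∩
        ⋂ T : Finset V, ⋃ j : V, {ω | j ∉ T ∧ PathConnectedIn h (activeSites ω) k j} := by
      ext ω
      simp only [infiniteCluster, Set.mem_ofPred_eq, Set.mem_inter_iff, Set.mem_iInter,
        Set.mem_iUnion]
      refine and_congr_right fun _ => ⟨fun hinf T => ?_, fun hall hfin => ?_⟩
      · obtain ⟨j, hj, hjT⟩ := hinf.exists_notMem_finset T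
        exact ⟨j, hjT, hj⟩
      · obtain ⟨j, hjT, hj⟩ := hall hfin.toFinset
        exact hjT (by simpa using hj)
    rw [this]
    refine ((isSiteField_activeSites Γ).measurableSet_mem k).inter ?_
    exact MeasurableSet.iInter fun T => MeasurableSet.iUnion fun j =>
      (MeasurableSet.const _).inter (measurableSet_pathConnectedIn h k j)

/-! ## Coercivity on finite sets -/

open Classical in
/-- The truncation of a function to `B ∩ S`. -/
noncomputable def truncate {V : Type*} (B : Finset V) (S : Set V) (f : V → ℝ) (k : V) : ℝ :=
  if k ∈ B ∧ k ∈ S then f k else 0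

/-- The Hamiltonian minus `E`, applied to functions supported in `B ∩ S`, is bounded below by
`√s`. -/
def IsCoerciveOn {V : Type*} {h : V → V → ℝ} (hfin : ∀ k, {j | h k j ≠ 0}.Finite)
    (ω : V → ℝ≥0∞) (S : Set V) (E : ℝ) (B : Finset V) (s : ℝ) : Prop :=
  ∀ f : V → ℝ, s * ∑ k ∈ B, truncate B S f k ^ 2 ≤
    ∑ k ∈ hoppingNbhd hfin B,
      S.indicator (fun k => (energyOp h ω (truncate B S f) k - E * truncate B S f k) ^ 2) k

section Coercive

variable {V : Type*} {h : V → V → ℝ}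

theorem mem_of_truncate_ne_zero {B : Finset V} {S : Set V} {f : V → ℝ} {k : V}
    (hk : truncate B S f k ≠ 0) : k ∈ B ∧ k ∈ S := by
  by_contra hn
  exact hk (if_neg hn)

theorem truncate_eq_self {B : Finset V} {S : Set V} {f : V → ℝ}
    (hf : ∀ k, f k ≠ 0 → k ∈ B ∧ k ∈ S) : truncate B S f = f := by
  funext k
  by_cases hk : k ∈ B ∧ k ∈ S
  · exact if_pos hk
  · rw [truncate, if_neg hk]
    by_contra h0
    exact hk (hf k (Ne.symm h0))

theorem energyOp_truncate {ω : V → ℝ≥0∞} (B : Finset V) (S : Set V) (f : V → ℝ) (k : V) :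
    energyOp h ω (truncate B S f) k =
      (ω k).toReal * truncate B S f k + ∑ j ∈ B, h k j * truncate B S f j :=
  energyOp_eq_sum B fun _ _ hj => (mem_of_truncate_ne_zero hj).1

theorem not_hasEigenfunctionOn_of_isCoerciveOn (hfin : ∀ k, {j | h k j ≠ 0}.Finite)
    {ω : V → ℝ≥0∞} {S : Set V} {E : ℝ} {B : Finset V} {s : ℝ} (hs : 0 < s)
    (hc : IsCoerciveOn hfin ω S E B s) : ¬ HasEigenfunctionOn h ω S E B := by
  rintro ⟨f, ⟨k₀, hk₀⟩, hsupp, heq⟩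
  have hcf := hc f
  rw [truncate_eq_self hsupp] at hcf
  have h0 : ∑ k ∈ hoppingNbhd hfin B,
      S.indicator (fun k => (energyOp h ω f k - E * f k) ^ 2) k = 0 := by
    refine Finset.sum_eq_zero fun k _ => ?_
    by_cases hk : k ∈ S
    · rw [Set.indicator_of_mem hk, heq k hk]; simp
    · exact Set.indicator_of_notMem hk _
  rw [h0] at hcf
  have hpos : 0 < ∑ k ∈ B, f k ^ 2 :=
    Finset.sum_pos' (fun k _ => sq_nonneg _) ⟨k₀, (hsupp k₀ hk₀).1, by positivity⟩
  exact absurd hcf (not_le.2 (by positivity))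

/-- Absence of eigenfunctions in `B` makes `H - E` an injective linear map between
finite-dimensional spaces, hence antilipschitz with some constant `K`. The factor `B.card` passes
from the sup norm to the sum of squares. -/
theorem exists_isCoerciveOn (hsymm : ∀ k j, h k j = h j k)
    (hfin : ∀ k, {j | h k j ≠ 0}.Finite) {ω : V → ℝ≥0∞} {S : Set V} {E : ℝ} {B : Finset V}
    (hn : ¬ HasEigenfunctionOn h ω S E B) :
    ∃ n : ℕ, IsCoerciveOn hfin ω S E B ((n : ℝ) + 1)⁻¹ := by
  classical
  let ext : ({k // k ∈ B ∧ k ∈ S} → ℝ) → V → ℝ := fun x k =>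
    if hk : k ∈ B ∧ k ∈ S then x ⟨k, hk⟩ else 0
  have hext : ∀ x k, ext x k ≠ 0 → k ∈ B ∧ k ∈ S := fun x k hk => by
    by_contra h0
    exact hk (dif_neg h0)
  have hadd : ∀ x y k, ext (x + y) k = ext x k + ext y k := fun x y k => by
    simp only [ext]
    split_ifs <;> simp
  have hsmul : ∀ (c : ℝ) x k, ext (c • x) k = c * ext x k := fun c x k => by
    simp only [ext]
    split_ifs <;> simp
  have hop : ∀ x k, energyOp h ω (ext x) k = (ω k).toReal * ext x k + ∑ j ∈ B, h k j * ext x j :=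
    fun x k => energyOp_eq_sum B fun j _ hj => (hext x j hj).1
  have : Fintype {k // k ∈ B ∧ k ∈ S} :=
    @Fintype.ofFinite _ (Set.Finite.to_subtype (B.finite_toSet.subset fun k hk => hk.1))
  let L : ({k // k ∈ B ∧ k ∈ S} → ℝ) →ₗ[ℝ] (hoppingNbhd hfin B → ℝ) :=
    { toFun := fun x k => S.indicator (fun k => energyOp h ω (ext x) k - E * ext x k) k
      map_add' := fun x y => by
        funext k
        by_cases hk : (k : V) ∈ S
        · simp only [Pi.add_apply, Set.indicator_of_mem hk, hop, hadd, mul_add,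
            Finset.sum_add_distrib]
          ring
        · simp [Set.indicator_of_notMem hk]
      map_smul' := fun c x => by
        funext k
        by_cases hk : (k : V) ∈ S
        · simp only [Pi.smul_apply, Set.indicator_of_mem hk, hop, hsmul, RingHom.id_apply,
            smul_eq_mul, mul_left_comm _ c, ← Finset.mul_sum]
          ring
        · simp [Set.indicator_of_notMem hk] }
  have hL : ∀ x k, L x k = S.indicator (fun k => energyOp h ω (ext x) k - E * ext x k) k :=
    fun _ _ => rfl
  have hker : LinearMap.ker L = ⊥ := by
    refine (LinearMap.ker_eq_bot').2 fun x hx => ?_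
    by_contra hx0
    obtain ⟨⟨k₀, hk₀⟩, hxk⟩ := Function.ne_iff.1 hx0
    refine hn ⟨ext x, ⟨k₀, by simpa [ext, hk₀] using hxk⟩, hext x, fun k hk => ?_⟩
    by_cases hkB : k ∈ hoppingNbhd hfin B
    · have := congrFun hx ⟨k, hkB⟩
      rw [hL, Set.indicator_of_mem hk] at this
      exact sub_eq_zero.1 this
    · have hkB' : k ∉ B := fun hk' => hkB (subset_hoppingNbhd hfin B hk')
      have hz : ext x k = 0 := dif_neg fun hk' => hkB' hk'.1
      rw [hop, hz, mul_zero, mul_zero, zero_add]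
      refine Finset.sum_eq_zero fun j hj => ?_
      rw [mem_hoppingNbhd] at hkB
      push Not at hkB
      rw [hsymm, hkB.2 j hj, zero_mul]
  obtain ⟨K, hK0, hK⟩ := L.exists_antilipschitzWith hker
  obtain ⟨n, hn⟩ := exists_nat_ge ((B.card : ℝ) * (K : ℝ) ^ 2)
  refine ⟨n, fun f => ?_⟩
  set x : {k // k ∈ B ∧ k ∈ S} → ℝ := fun k => f k with hx
  have hxf : truncate B S f = ext x := by
    funext k
    simp only [truncate, ext, hx]
    split_ifs <;> rfl
  rw [hxf, inv_mul_le_iff₀ (by positivity)]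
  set Q := ∑ k ∈ hoppingNbhd hfin B,
    S.indicator (fun k => (energyOp h ω (ext x) k - E * ext x k) ^ 2) k with hQ
  have hQL : Q = ∑ k, L x k ^ 2 := by
    rw [hQ, ← Finset.sum_coe_sort]
    refine Finset.sum_congr rfl fun k _ => ?_
    rw [hL]
    by_cases hk : (k : V) ∈ S
    · simp [Set.indicator_of_mem hk]
    · simp [Set.indicator_of_notMem hk]
  have hQ0 : 0 ≤ Q := hQL ▸ Finset.sum_nonneg fun k _ => sq_nonneg _
  have hLQ : ‖L x‖ ^ 2 ≤ Q := by
    have : ‖L x‖ ≤ √Q := (pi_norm_le_iff_of_nonneg (Real.sqrt_nonneg _)).2 fun k => by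
      refine Real.le_sqrt_of_sq_le ?_
      rw [hQL, Real.norm_eq_abs, sq_abs]
      exact Finset.single_le_sum (f := fun k => L x k ^ 2) (fun k _ => sq_nonneg _)
        (Finset.mem_univ k)
    calc ‖L x‖ ^ 2 ≤ √Q ^ 2 := by gcongr
      _ = Q := Real.sq_sqrt hQ0
  have hnorm : ‖x‖ ≤ K * ‖L x‖ := by
    have := hK.le_mul_dist x 0
    simpa using this
  have hterm : ∀ k, ext x k ^ 2 ≤ ‖x‖ ^ 2 := fun k => by
    by_cases hk : k ∈ B ∧ k ∈ S
    · have := norm_le_pi_norm x ⟨k, hk⟩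
      rw [Real.norm_eq_abs] at this
      simp only [ext, dif_pos hk]
      rw [← sq_abs]
      gcongr
    · simp [ext, dif_neg hk]
  calc ∑ k ∈ B, ext x k ^ 2 ≤ ∑ _k ∈ B, ‖x‖ ^ 2 := Finset.sum_le_sum fun k _ => hterm k
    _ = B.card * ‖x‖ ^ 2 := by simp
    _ ≤ B.card * (K * ‖L x‖) ^ 2 := by gcongr
    _ = (B.card * (K : ℝ) ^ 2) * ‖L x‖ ^ 2 := by ring
    _ ≤ (n + 1) * Q := by gcongr; linarith

end Coercive

section SiteField

variable {V Γ : Type*} [Group Γ] [MulAction Γ V] {h : V → V → ℝ} {S : (V → ℝ≥0∞) → Set V}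

/-- For fixed `ω` both sides are continuous in `f`, so it is enough to test a countable dense family
of functions. For fixed `f` both sides are measurable in `ω`. -/
theorem measurableSet_isCoerciveOn [Countable V] (hfin : ∀ k, {j | h k j ≠ 0}.Finite)
    (hS : IsSiteField Γ S) (E : ℝ) (B : Finset V) (s : ℝ) :
    MeasurableSet {ω | IsCoerciveOn hfin ω (S ω) E B s} := by
  classical
  have heq : {ω | IsCoerciveOn hfin ω (S ω) E B s} = ⋂ n : ℕ, {ω |
      s * ∑ k ∈ B, truncate B (S ω) (TopologicalSpace.denseSeq (V → ℝ) n) k ^ 2 ≤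
      ∑ k ∈ hoppingNbhd hfin B, (S ω).indicator (fun k =>
        (energyOp h ω (truncate B (S ω) (TopologicalSpace.denseSeq (V → ℝ) n)) k -
          E * truncate B (S ω) (TopologicalSpace.denseSeq (V → ℝ) n) k) ^ 2) k} := by
    ext ω
    simp only [Set.mem_ofPred_eq, Set.mem_iInter]
    refine ⟨fun hc n => hc _, fun hall f => ?_⟩
    have htr : ∀ k, Continuous fun f : V → ℝ => truncate B (S ω) f k := fun k => by
      unfold truncate
      split_ifs
      · exact continuous_apply k
      · exact continuous_const
    have hop : ∀ k, Continuous fun f : V → ℝ => energyOp h ω (truncate B (S ω) f) k := fun k => by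
      simp_rw [energyOp_truncate]
      fun_prop
    have hclosed : IsClosed {f : V → ℝ | s * ∑ k ∈ B, truncate B (S ω) f k ^ 2 ≤
        ∑ k ∈ hoppingNbhd hfin B, (S ω).indicator (fun k =>
          (energyOp h ω (truncate B (S ω) f) k - E * truncate B (S ω) f k) ^ 2) k} := by
      refine isClosed_le (by fun_prop) (continuous_finsetSum _ fun k _ => ?_)
      by_cases hk : k ∈ S ω
      · simp only [Set.indicator_of_mem hk]
        fun_prop
      · simp only [Set.indicator_of_notMem hk]
        exact continuous_const
    have hsub := hclosed.closure_subset_iff.2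
      (show Set.range (TopologicalSpace.denseSeq (V → ℝ)) ⊆ _ by
        rintro _ ⟨n, rfl⟩
        exact hall n)
    exact hsub ((TopologicalSpace.denseRange_denseSeq (V → ℝ)) f)
  rw [heq]
  refine MeasurableSet.iInter fun n => ?_
  generalize TopologicalSpace.denseSeq (V → ℝ) n = f
  have htr : ∀ k, Measurable fun ω => truncate B (S ω) f k := fun k =>
    Measurable.ite ((MeasurableSet.const _).inter (hS.measurableSet_mem k)) measurable_const
      measurable_const
  have hop : ∀ k, Measurable fun ω => energyOp h ω (truncate B (S ω) f) k := fun k => by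
    simp_rw [energyOp_truncate]
    have : Measurable fun ω : V → ℝ≥0∞ => (ω k).toReal := (measurable_pi_apply k).ennreal_toReal
    fun_prop
  refine measurableSet_le (by fun_prop) (Finset.measurable_sum _ fun k _ => ?_)
  simp only [Set.indicator_apply]
  exact Measurable.ite (hS.measurableSet_mem k) (by fun_prop) measurable_const

/-- The event is an uncountable union over functions; its complement is a countable union of
coercivity events. -/
theorem measurableSet_hasEigenfunctionOn [Countable V] (hsymm : ∀ k j, h k j = h j k)
    (hfin : ∀ k, {j | h k j ≠ 0}.Finite) (hS : IsSiteField Γ S) (E : ℝ) (B : Finset V) :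
    MeasurableSet {ω | HasEigenfunctionOn h ω (S ω) E B} := by
  have heq : {ω | HasEigenfunctionOn h ω (S ω) E B} =
      (⋃ n : ℕ, {ω | IsCoerciveOn hfin ω (S ω) E B ((n : ℝ) + 1)⁻¹})ᶜ := by
    ext ω
    simp only [Set.mem_ofPred_eq, Set.mem_compl_iff, Set.mem_iUnion]
    rw [iff_not_comm]
    exact ⟨fun ⟨n, hn⟩ => not_hasEigenfunctionOn_of_isCoerciveOn hfin (by positivity) hn,
      exists_isCoerciveOn hsymm hfin⟩
  rw [heq]
  exact (MeasurableSet.iUnion fun n => measurableSet_isCoerciveOn hfin hS E B _).compl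

theorem HasEigenfunctionOn.of_shift (hinv : ∀ (γ : Γ) k j, h (γ • k) (γ • j) = h k j)
    (hS : IsSiteField Γ S) {γ : Γ} {ω : V → ℝ≥0∞} {E : ℝ} {B : Finset V}
    (hB : HasEigenfunctionOn h (shift γ ω) (S (shift γ ω)) E B) :
    ∃ f : V → ℝ, (∃ k, f k ≠ 0) ∧ (∀ k, f k ≠ 0 → γ • k ∈ B ∧ k ∈ S ω) ∧
      ∀ k ∈ S ω, energyOp h ω f k = E * f k := by
  obtain ⟨f, ⟨k₀, hk₀⟩, hsupp, heq⟩ := hB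
  refine ⟨fun k => f (γ • k), ⟨γ⁻¹ • k₀, by simpa using hk₀⟩, fun k hk => ?_, fun k hk => ?_⟩
  · have := hsupp _ hk
    rwa [hS.mem_shift, inv_smul_smul] at this
  · have := heq (γ • k) (by rwa [hS.mem_shift, inv_smul_smul])
    rwa [energyOp_shift hinv, inv_smul_smul] at this

theorem mem_sigmaFin_of_shift (hfin : ∀ k, {j | h k j ≠ 0}.Finite)
    (hinv : ∀ (γ : Γ) k j, h (γ • k) (γ • j) = h k j)
    (hS : IsSiteField Γ S) {γ : Γ} {ω : V → ℝ≥0∞} {E : ℝ}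
    (hE : E ∈ sigmaFin h (shift γ ω) (S (shift γ ω))) : E ∈ sigmaFin h ω (S ω) := by
  classical
  rw [mem_sigmaFin_iff hfin] at hE ⊢
  obtain ⟨B, hB⟩ := hE
  obtain ⟨f, hne, hsupp, heq⟩ := hB.of_shift hinv hS
  refine ⟨γ⁻¹ • B, f, hne, fun k hk => ⟨?_, (hsupp k hk).2⟩, heq⟩
  exact Finset.mem_inv_smul_finset_iff.2 (hsupp k hk).1

theorem mem_sigmaFin_shift_iff (hfin : ∀ k, {j | h k j ≠ 0}.Finite)
    (hinv : ∀ (γ : Γ) k j, h (γ • k) (γ • j) = h k j)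
    (hS : IsSiteField Γ S) (γ : Γ) (ω : V → ℝ≥0∞) (E : ℝ) :
    E ∈ sigmaFin h (shift γ ω) (S (shift γ ω)) ↔ E ∈ sigmaFin h ω (S ω) := by
  refine ⟨mem_sigmaFin_of_shift hfin hinv hS, fun hE => ?_⟩
  refine mem_sigmaFin_of_shift hfin hinv hS (γ := γ⁻¹) ?_
  rwa [shift_inv_shift]

theorem IsCoerciveOn.of_shift {hfin : ∀ k, {j | h k j ≠ 0}.Finite}
    (hinv : ∀ (γ : Γ) k j, h (γ • k) (γ • j) = h k j)
    (hS : IsSiteField Γ S) {γ : Γ} {ω : V → ℝ≥0∞} {E : ℝ} {B : Finset V} {s : ℝ}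
    (hc : IsCoerciveOn hfin (shift γ ω) (S (shift γ ω)) E B s) {f : V → ℝ}
    (hf : ∀ k, f k ≠ 0 → γ • k ∈ B ∧ k ∈ S ω) :
    s * ∑ k ∈ B, f (γ⁻¹ • k) ^ 2 ≤ ∑ k ∈ hoppingNbhd hfin B,
      (S ω).indicator (fun k => (energyOp h ω f k - E * f k) ^ 2) (γ⁻¹ • k) := by
  have hcf := hc fun k => f (γ⁻¹ • k)
  rw [truncate_eq_self] at hcf
  · refine hcf.trans_eq (Finset.sum_congr rfl fun k _ => ?_)
    by_cases hk : γ⁻¹ • k ∈ S ω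
    · rw [Set.indicator_of_mem hk, Set.indicator_of_mem ((hS.mem_shift _ _ _).2 hk),
        energyOp_shift hinv]
      simp only [inv_smul_smul]
    · rw [Set.indicator_of_notMem hk, Set.indicator_of_notMem (mt (hS.mem_shift _ _ _).1 hk)]
  · intro k hk
    have := hf _ hk
    rwa [smul_inv_smul, ← hS.mem_shift] at this

/-- By ergodicity, an energy belongs to `σ_fin` almost surely or almost never. -/
theorem mem_almostSureSigmaFin_or [Countable V] (hsymm : ∀ k j, h k j = h j k)
    (hfin : ∀ k, {j | h k j ≠ 0}.Finite)
    (hinv : ∀ (γ : Γ) k j, h (γ • k) (γ • j) = h k j)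
    (hS : IsSiteField Γ S) {P : Measure (V → ℝ≥0∞)} [IsProbabilityMeasure P]
    (hP : IsErgodicField Γ P) (E : ℝ) :
    E ∈ almostSureSigmaFin h P S ∨ ∀ᵐ ω ∂P, E ∉ sigmaFin h ω (S ω) := by
  have hmeas : MeasurableSet {ω | E ∈ sigmaFin h ω (S ω)} := by
    simp_rw [mem_sigmaFin_iff hfin, Set.ofPred_exists]
    exact MeasurableSet.iUnion fun B => measurableSet_hasEigenfunctionOn hsymm hfin hS E B
  rcases hP.ergodic _ hmeas fun γ => by
      ext ω
      exact mem_sigmaFin_shift_iff hfin hinv hS γ ω E with h0 | h1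
  · right
    rw [ae_iff]
    simpa using h0
  · left
    exact (prob_compl_eq_zero_iff hmeas).2 h1

theorem not_uniqueContinuation_iff [Countable V] {G : SimpleGraph V} (hconn : G.Connected)
    {R : ℕ} (hsymm : ∀ k j, h k j = h j k)
    (hfin : ∀ k, {j | h k j ≠ 0}.Finite) (hrange : ∀ k j, R ≤ G.dist k j → h k j = 0)
    (hinv : ∀ (γ : Γ) k j, h (γ • k) (γ • j) = h k j)
    (hS : IsSiteField Γ S) {P : Measure (V → ℝ≥0∞)} [IsProbabilityMeasure P]
    (hP : IsErgodicField Γ P) (E : ℝ) :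
    ¬ UniqueContinuation G R h P S E ↔ E ∈ almostSureSigmaFin h P S := by
  constructor
  · intro hn
    refine (mem_almostSureSigmaFin_or hsymm hfin hinv hS hP E).resolve_right fun hnot => hn ?_
    intro Λ
    filter_upwards [hnot] with ω hω f hsol hbd
    by_contra! hne
    exact hω (mem_sigmaFin_of_vanishing G hconn hfin hrange hsol hbd hne)
  · intro hE hU
    have hE' : ∀ᵐ ω ∂P, E ∈ sigmaFin h ω (S ω) := hE
    -- Countability puts all finite `Λ` into one almost sure event, so `Λ` may be the support of an
    -- eigenfunction that depends on `ω`.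
    have : Countable (Finset V) := inferInstance
    obtain ⟨ω, hω, hUω⟩ := (hE'.and (ae_all_iff.2 hU)).exists
    obtain ⟨f, hf0, hfs, hsol⟩ := hω
    refine hf0 (lp.ext (funext fun k => ?_))
    by_contra hk
    refine hk (hUω hfs.toFinset f hsol (fun j hj => ?_) k (by simpa using hk))
    by_contra hj0
    exact hj.1 (by simpa using hj0)

end SiteField

/-! ## Eigenvectors of the finite-volume restrictions -/

open Classical in
/-- The sites of `S` in the finite box `Λ`. -/
noncomputable abbrev sitesIn {V : Type*} (S : Set V) (Λ : Finset V) : Finset V :=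
  Λ.filter (· ∈ S)

open Classical in
/-- The eigenvalues of the restriction of the Hamiltonian to `Λ ∩ S`. -/
noncomputable def siteEigenvalue {V : Type*} {h : V → V → ℝ} (hsymm : ∀ k j, h k j = h j k)
    (ω : V → ℝ≥0∞) (S : Set V) (Λ : Finset V) (i : sitesIn S Λ) : ℝ :=
  (isHermitian_restrictedMatrix hsymm ω (sitesIn S Λ)).eigenvalues i

open Classical in
/-- The normalised eigenvectors of the restriction of the Hamiltonian to `Λ ∩ S`, extended by `0`. -/
noncomputable def siteEigenvector {V : Type*} {h : V → V → ℝ} (hsymm : ∀ k j, h k j = h j k)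
    (ω : V → ℝ≥0∞) (S : Set V) (Λ : Finset V) (i : sitesIn S Λ) (k : V) : ℝ :=
  if hk : k ∈ sitesIn S Λ then
    (isHermitian_restrictedMatrix hsymm ω (sitesIn S Λ)).eigenvectorBasis i ⟨k, hk⟩ else 0

section Spectral

variable {V : Type*} {h : V → V → ℝ} (hsymm : ∀ k j, h k j = h j k) (ω : V → ℝ≥0∞) (S : Set V)
  (Λ : Finset V)

open Classical in
theorem countingFunction_eq (E : ℝ) : countingFunction hsymm ω S Λ E =
    ((Finset.univ.filter fun i => siteEigenvalue hsymm ω S Λ i < E).card : ℝ) / Λ.card :=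
  rfl

variable {hsymm ω S Λ} in
theorem mem_of_siteEigenvector_ne_zero {i : sitesIn S Λ} {k : V}
    (hk : siteEigenvector hsymm ω S Λ i k ≠ 0) : k ∈ Λ ∧ k ∈ S := by
  by_contra hn
  exact hk (dif_neg (by simpa using hn))

theorem siteEigenvector_of_notMem {i : sitesIn S Λ} {k : V} (hk : k ∉ sitesIn S Λ) :
    siteEigenvector hsymm ω S Λ i k = 0 := by
  classical
  exact dif_neg hk

theorem sum_siteEigenvector_sq_le_one (k : V) :
    ∑ i, siteEigenvector hsymm ω S Λ i k ^ 2 ≤ 1 := by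
  classical
  by_cases hk : k ∈ sitesIn S Λ
  · have := (isHermitian_restrictedMatrix hsymm ω
      (sitesIn S Λ)).eigenvectorBasis.sum_sq_norm_inner_right
      (EuclideanSpace.single ⟨k, hk⟩ (1 : ℝ))
    simp only [EuclideanSpace.inner_single_right, PiLp.norm_single] at this
    simp only [siteEigenvector, dif_pos hk]
    refine le_of_eq ?_
    simpa using this
  · simp [siteEigenvector_of_notMem hsymm ω S Λ hk]

theorem sum_sq_sum_siteEigenvector (c : sitesIn S Λ → ℝ) :
    ∑ k ∈ Λ, (∑ i, c i * siteEigenvector hsymm ω S Λ i k) ^ 2 = ∑ i, c i ^ 2 := by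
  classical
  set b := (isHermitian_restrictedMatrix hsymm ω (sitesIn S Λ)).eigenvectorBasis with hb
  set x := b.repr.symm (WithLp.toLp 2 c) with hx
  have hnx : ‖x‖ ^ 2 = ∑ i, c i ^ 2 := by
    rw [hx, LinearIsometryEquiv.norm_map, EuclideanSpace.norm_sq_eq]
    simp
  have hxk : ∀ k : sitesIn S Λ, x k = ∑ i, c i * siteEigenvector hsymm ω S Λ i k := fun k => by
    have : x = ∑ i, c i • b i := by rw [hx, ← b.sum_repr_symm]
    rw [this]
    simp [siteEigenvector, hb]
  rw [← hnx, EuclideanSpace.norm_sq_eq]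
  simp_rw [hxk, Real.norm_eq_abs, sq_abs]
  rw [Finset.sum_coe_sort (sitesIn S Λ)
    (fun k => (∑ i, c i * siteEigenvector hsymm ω S Λ i k) ^ 2)]
  symm
  refine Finset.sum_subset (Finset.filter_subset _ _) fun k hk hkS => ?_
  simp [siteEigenvector_of_notMem hsymm ω S Λ hkS]

theorem sum_siteEigenvector_sq (i : sitesIn S Λ) :
    ∑ k ∈ Λ, siteEigenvector hsymm ω S Λ i k ^ 2 = 1 := by
  classical
  have := sum_sq_sum_siteEigenvector hsymm ω S Λ (Pi.single i 1)
  simpa [Pi.single_apply, ite_pow] using this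

theorem restrictedMatrix_mulVec (f : V → ℝ) (hf : ∀ k, f k ≠ 0 → k ∈ sitesIn S Λ)
    (k : sitesIn S Λ) :
    (restrictedMatrix h ω (sitesIn S Λ)).mulVec (fun j => f j) k = energyOp h ω f k := by
  classical
  rw [energyOp_eq_sum (sitesIn S Λ) fun j _ hj => hf j hj, restrictedMatrix, Matrix.add_mulVec,
    Pi.add_apply, Matrix.mulVec_diagonal]
  congr 1
  simp only [Matrix.mulVec, dotProduct, Matrix.of_apply]
  exact Finset.sum_coe_sort (sitesIn S Λ) (fun j => h k j * f j)

theorem siteEigenvector_mem {i : sitesIn S Λ} {k : V}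
    (hk : siteEigenvector hsymm ω S Λ i k ≠ 0) : k ∈ sitesIn S Λ := by
  classical
  exact Finset.mem_filter.2 (mem_of_siteEigenvector_ne_zero hk)

theorem energyOp_siteEigenvector (i : sitesIn S Λ) {k : V} (hkΛ : k ∈ Λ) (hkS : k ∈ S) :
    energyOp h ω (siteEigenvector hsymm ω S Λ i) k =
      siteEigenvalue hsymm ω S Λ i * siteEigenvector hsymm ω S Λ i k := by
  classical
  have hk : k ∈ sitesIn S Λ := Finset.mem_filter.2 ⟨hkΛ, hkS⟩
  have hv : (fun j : sitesIn S Λ => siteEigenvector hsymm ω S Λ i j) =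
      ⇑((isHermitian_restrictedMatrix hsymm ω (sitesIn S Λ)).eigenvectorBasis i) := by
    funext j
    simp [siteEigenvector]
  have := congrFun ((isHermitian_restrictedMatrix hsymm ω
    (sitesIn S Λ)).mulVec_eigenvectorBasis i) ⟨k, hk⟩
  rw [← hv] at this
  rw [← restrictedMatrix_mulVec ω S Λ _ (fun k hk => siteEigenvector_mem hsymm ω S Λ hk) ⟨k, hk⟩]
  exact this

open Classical in
/-- If a non-zero solution is supported in `C ⊆ Λ`, then the eigenvectors at the energy `E` of the
restriction to `Λ` carry at least unit mass on `C`. -/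
theorem one_le_sum_siteEigenvector_sq {E : ℝ} {C : Finset V} (hC : C ⊆ Λ) {f : V → ℝ}
    (hne : ∃ k, f k ≠ 0) (hsupp : ∀ k, f k ≠ 0 → k ∈ C ∧ k ∈ S)
    (heq : ∀ k ∈ S, energyOp h ω f k = E * f k) :
    1 ≤ ∑ k ∈ C, ∑ i with siteEigenvalue hsymm ω S Λ i = E,
      siteEigenvector hsymm ω S Λ i k ^ 2 := by
  set A := restrictedMatrix h ω (sitesIn S Λ) with hA
  set hAH := isHermitian_restrictedMatrix hsymm ω (sitesIn S Λ) with hAH'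
  set b := hAH.eigenvectorBasis with hb
  have hsupp' : ∀ k, f k ≠ 0 → k ∈ sitesIn S Λ := fun k hk =>
    Finset.mem_filter.2 ⟨hC (hsupp k hk).1, (hsupp k hk).2⟩
  set x : EuclideanSpace ℝ (sitesIn S Λ) := WithLp.toLp 2 (fun k => f k) with hx
  have hAx : A.mulVec x.ofLp = E • x.ofLp := by
    funext k
    exact (restrictedMatrix_mulVec ω S Λ f hsupp' k).trans
      (heq k (Finset.mem_filter.1 k.2).2)
  -- The matrix is symmetric and `f` restricts to an eigenvector at `E`, so it is orthogonal to the
  -- eigenvectors at other energies.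
  have hc0 : ∀ i, siteEigenvalue hsymm ω S Λ i ≠ E → inner ℝ (b i) x = 0 := fun i hi => by
    have h1 : dotProduct (A.mulVec (b i).ofLp) x.ofLp = dotProduct (b i).ofLp (A.mulVec x.ofLp) := by
      rw [Matrix.dotProduct_mulVec, ← Matrix.mulVec_transpose]
      congr 2
      have := hAH.eq
      rwa [Matrix.conjTranspose_eq_transpose_of_trivial, eq_comm] at this
    rw [hAx, hAH.mulVec_eigenvectorBasis i, smul_dotProduct, dotProduct_smul] at h1
    have h2 : inner ℝ (b i) x = dotProduct (b i).ofLp x.ofLp := by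
      rw [EuclideanSpace.inner_eq_star_dotProduct, dotProduct_comm]; simp
    rw [h2]
    have h3 : (siteEigenvalue hsymm ω S Λ i - E) * dotProduct (b i).ofLp x.ofLp = 0 := by
      rw [sub_mul, sub_eq_zero]; exact h1
    exact (mul_eq_zero.1 h3).resolve_left (sub_ne_zero.2 hi)
  have hnorm : ‖x‖ ^ 2 = ∑ k ∈ C, f k ^ 2 := by
    rw [EuclideanSpace.norm_sq_eq]
    simp only [hx, Real.norm_eq_abs, sq_abs]
    rw [Finset.sum_coe_sort (sitesIn S Λ) (fun k => f k ^ 2)]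
    rw [← Finset.sum_subset (Finset.filter_subset (· ∈ sitesIn S Λ) C) fun k hk hkS => ?_]
    · refine (Finset.sum_subset (fun k hk => (Finset.mem_filter.1 hk).2) fun k hk hkC => ?_).symm
      by_contra h0
      exact hkC (Finset.mem_filter.2 ⟨(hsupp k (by simpa using h0)).1, hk⟩)
    · by_contra h0
      exact hkS (Finset.mem_filter.2 ⟨hk, hsupp' k (by simpa using h0)⟩)
  have hfk : ∀ k, f k = ∑ i with siteEigenvalue hsymm ω S Λ i = E,
      inner ℝ (b i) x * siteEigenvector hsymm ω S Λ i k := fun k => by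
    rw [Finset.sum_filter_of_ne fun i _ hi => by
      by_contra hne
      exact hi (by rw [hc0 i hne, zero_mul])]
    by_cases hk : k ∈ sitesIn S Λ
    · have : x.ofLp ⟨k, hk⟩ = f k := rfl
      rw [← this]
      conv_lhs => rw [← b.sum_repr' x]
      simp [siteEigenvector, hk, hb]
    · have h0 : f k = 0 := by
        by_contra h0
        exact hk (hsupp' k h0)
      simp [h0, siteEigenvector, hk]
  have hbessel : ∑ i with siteEigenvalue hsymm ω S Λ i = E, inner ℝ (b i) x ^ 2 ≤ ‖x‖ ^ 2 := by
    rw [← b.sum_sq_norm_inner_right x]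
    simp only [Real.norm_eq_abs, sq_abs]
    exact Finset.sum_le_sum_of_subset_of_nonneg (Finset.filter_subset _ _)
      fun i _ _ => sq_nonneg _
  have hpos : 0 < ‖x‖ ^ 2 := by
    obtain ⟨k, hk⟩ := hne
    rw [hnorm]
    exact Finset.sum_pos' (fun k _ => sq_nonneg _) ⟨k, (hsupp k hk).1, by positivity⟩
  refine le_of_mul_le_mul_left ?_ hpos
  rw [mul_one, Finset.mul_sum]
  -- Expand `f` in the eigenvectors at `E` and apply Cauchy–Schwarz at each site of `C`; the
  -- coefficients are bounded by Bessel.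
  calc ‖x‖ ^ 2 = ∑ k ∈ C, f k ^ 2 := hnorm
    _ ≤ _ := Finset.sum_le_sum fun k _ => by
      rw [hfk k]
      refine (Finset.sum_mul_sq_le_sq_mul_sq _ _ _).trans ?_
      gcongr

end Spectral

/-! ## Følner sets and translates of finite sets of sites -/

open Classical in
/-- The elements of `I` whose left translates by `Q` stay in `I`. -/
noncomputable def core {Γ : Type*} [Group Γ] (Q I : Finset Γ) : Finset Γ :=
  I.filter fun g => ∀ q ∈ Q, q * g ∈ I

section Core

variable {V Γ : Type*} [Group Γ] [MulAction Γ V]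

theorem mem_core {Q I : Finset Γ} {g : Γ} : g ∈ core Q I ↔ g ∈ I ∧ ∀ q ∈ Q, q * g ∈ I := by
  classical
  simp [core]

theorem core_subset (Q I : Finset Γ) : core Q I ⊆ I := fun _ hg => (mem_core.1 hg).1

-- If `g ∈ I` is not in the core, some `q * g` lies in `Q * I` but not in `I`; thus `g` lies in one
-- of `Q.card` translates of the symmetric difference.
open Classical in
theorem card_sdiff_core_le (Q I : Finset Γ) :
    (I \ core Q I).card ≤ Q.card * (I ∆ (Q * I)).card := by
  refine (Finset.card_le_card (t := Q.biUnion fun q => (I ∆ (Q * I)).image (q⁻¹ * ·)) ?_).trans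
    (Finset.card_biUnion_le_card_mul _ _ _ fun q _ => Finset.card_image_le)
  intro g hg
  rw [Finset.mem_sdiff, mem_core] at hg
  obtain ⟨hgI, hn⟩ := hg
  push Not at hn
  obtain ⟨q, hq, hqg⟩ := hn hgI
  simp only [Finset.mem_biUnion, Finset.mem_image]
  exact ⟨q, hq, q * g, Finset.mem_symmDiff.2 (Or.inr ⟨Finset.mul_mem_mul hq hgI, hqg⟩), by simp⟩

open Classical in
theorem IsFolnerSequence.eventually_card_sdiff_core_le {I : ℕ → Finset Γ}
    (hI : IsFolnerSequence I) (Q : Finset Γ) {ε : ℝ} (hε : 0 < ε) :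
    ∀ᶠ L in atTop, ((I L \ core Q (I L)).card : ℝ) ≤ ε * (I L).card := by
  -- The Følner condition covers only non-empty sets; for empty `Q` the core is all of `I L`.
  rcases Q.eq_empty_or_nonempty with rfl | hQ
  · refine Eventually.of_forall fun L => ?_
    have := card_sdiff_core_le ∅ (I L)
    rw [Finset.card_empty, zero_mul, Nat.le_zero] at this
    rw [this, Nat.cast_zero]
    positivity
  · have hQ0 : (0 : ℝ) < Q.card := by exact_mod_cast hQ.card_pos
    filter_upwards [hI.folner Q hQ (ε / Q.card) (by positivity)] with L hL
    calc ((I L \ core Q (I L)).card : ℝ) ≤ Q.card * (I L ∆ (Q * I L)).card := by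
          exact_mod_cast card_sdiff_core_le Q (I L)
      _ ≤ Q.card * (ε / Q.card * (I L).card) := by gcongr
      _ = ε * (I L).card := by field_simp

variable {F : Finset V} {I : ℕ → Finset Γ}

theorem mem_exhaustion {L : ℕ} {v : V} :
    v ∈ exhaustion F I L ↔ ∃ g ∈ I L, ∃ f ∈ F, g⁻¹ • f = v := by
  classical
  simp only [exhaustion, Finset.mem_smul, Finset.mem_inv]
  constructor
  · rintro ⟨_, ⟨g, hg, rfl⟩, f, hf, rfl⟩
    exact ⟨g, hg, f, hf, rfl⟩
  · rintro ⟨g, hg, f, hf, rfl⟩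
    exact ⟨g⁻¹, ⟨g, hg, rfl⟩, f, hf, rfl⟩

theorem card_exhaustion_le (F : Finset V) (I : ℕ → Finset Γ) (L : ℕ) :
    (exhaustion F I L).card ≤ F.card * (I L).card := by
  classical
  unfold exhaustion
  refine Finset.card_smul_le.trans ?_
  rw [Finset.card_inv, mul_comm]

theorem exists_core_translate_mem (hF : ∀ v : V, ∃ γ : Γ, γ • v ∈ F) (I : ℕ → Finset Γ)
    (B : Finset V) :
    ∃ Q : Finset Γ, ∀ L, ∀ g ∈ core Q (I L), ∀ b ∈ B, g⁻¹ • b ∈ exhaustion F I L := by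
  classical
  choose κ hκ using hF
  -- With `κ b • b ∈ F`, one has `g⁻¹ • b = (κ b * g)⁻¹ • (κ b • b)`, so membership in the box only
  -- needs `κ b * g ∈ I L`.
  refine ⟨B.image κ, fun L g hg b hb => ?_⟩
  refine mem_exhaustion.2 ⟨κ b * g, (mem_core.1 hg).2 _ (Finset.mem_image_of_mem κ hb), _, hκ b, ?_⟩
  rw [mul_inv_rev, mul_smul, inv_smul_smul]

-- For fixed `k`, the solutions `g` of `g⁻¹ • k = v` differ by elements of the finite stabilizer of
-- `k`. This bounds the overlap of the translates of `C` uniformly.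
open Classical in
theorem exists_card_translates_le (hstab : ∀ v : V, Finite (MulAction.stabilizer Γ v))
    (C : Finset V) : ∃ M : ℕ, ∀ (v : V) (J : Finset Γ),
      ((J ×ˢ C).filter fun p : Γ × V => p.1⁻¹ • p.2 = v).card ≤ M := by
  classical
  refine ⟨C.card * C.sup fun k => Nat.card (MulAction.stabilizer Γ k), fun v J => ?_⟩
  have hsub : ((J ×ˢ C).filter fun p : Γ × V => p.1⁻¹ • p.2 = v) ⊆ C.biUnion fun k =>
      ((J.filter fun g => g⁻¹ • k = v).image fun g => (g, k)) := by
    rintro ⟨g, k⟩ hgk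
    simp only [Finset.mem_filter, Finset.mem_product] at hgk
    simp only [Finset.mem_biUnion, Finset.mem_image, Finset.mem_filter]
    exact ⟨k, hgk.1.2, g, ⟨hgk.1.1, hgk.2⟩, rfl⟩
  refine (Finset.card_le_card hsub).trans (Finset.card_biUnion_le_card_mul _ _ _ fun k hk => ?_)
  refine Finset.card_image_le.trans (le_trans ?_
    (Finset.le_sup (f := fun k => Nat.card (MulAction.stabilizer Γ k)) hk))
  rcases (J.filter fun g => g⁻¹ • k = v).eq_empty_or_nonempty with he | ⟨g₀, hg₀⟩
  · simp [he]
  · have := hstab k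
    have hg₀v := (Finset.mem_filter.1 hg₀).2
    have hfix : ∀ g : (J.filter fun g => g⁻¹ • k = v),
        (g : Γ) * g₀⁻¹ ∈ MulAction.stabilizer Γ k := fun g => by
      have hg := (Finset.mem_filter.1 g.2).2
      rw [MulAction.mem_stabilizer_iff, mul_smul, hg₀v]
      exact (inv_smul_eq_iff.1 hg).symm
    rw [← Fintype.card_coe, ← Nat.card_eq_fintype_card]
    refine Nat.card_le_card_of_injective (fun g => ⟨(g : Γ) * g₀⁻¹, hfix g⟩) fun a b hab => ?_
    exact Subtype.ext (mul_right_cancel (congrArg Subtype.val hab))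

open Classical in
theorem sum_translates_le {C : Finset V} {M : ℕ} (hM : ∀ (v : V) (J : Finset Γ),
      ((J ×ˢ C).filter fun p : Γ × V => p.1⁻¹ • p.2 = v).card ≤ M) (J : Finset Γ) (Λ : Finset V)
    {φ : V → ℝ} (hφ : ∀ v, 0 ≤ φ v) (hsupp : ∀ v, φ v ≠ 0 → v ∈ Λ) :
    ∑ g ∈ J, ∑ k ∈ C, φ (g⁻¹ • k) ≤ M * ∑ v ∈ Λ, φ v := by
  classical
  have hexp : ∀ w, φ w = ∑ v ∈ Λ, if w = v then φ v else 0 := fun w => by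
    rw [Finset.sum_ite_eq]
    split_ifs with hw
    · rfl
    · by_contra h0
      exact hw (hsupp w h0)
  rw [← Finset.sum_product (f := fun p => φ (p.1⁻¹ • p.2))]
  simp_rw [fun p : Γ × V => hexp (p.1⁻¹ • p.2)]
  rw [Finset.sum_comm, Finset.mul_sum]
  refine Finset.sum_le_sum fun v _ => ?_
  rw [← Finset.sum_filter, Finset.sum_const, nsmul_eq_mul]
  exact mul_le_mul_of_nonneg_right (by exact_mod_cast hM v J) (hφ v)

/-- The IDS is normalised by the box, frequencies of events by `I L`. This comparison holds because
`g ↦ g⁻¹ • f` is boundedly many to one. -/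
theorem exists_card_le_mul_card_exhaustion (hstab : ∀ v : V, Finite (MulAction.stabilizer Γ v))
    (hF : F.Nonempty) (I : ℕ → Finset Γ) :
    ∃ M : ℕ, ∀ L, ((I L).card : ℝ) ≤ M * (exhaustion F I L).card := by
  classical
  obtain ⟨f, hf⟩ := hF
  obtain ⟨M, hM⟩ := exists_card_translates_le hstab {f}
  refine ⟨M, fun L => ?_⟩
  have := sum_translates_le hM (I L) (exhaustion F I L)
    (φ := fun v => if v ∈ exhaustion F I L then 1 else 0)
    (fun v => by split_ifs <;> norm_num) (fun v hv => by by_contra hn; simp [hn] at hv)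
  have h1 : ∀ g ∈ I L, g⁻¹ • f ∈ exhaustion F I L := fun g hg => mem_exhaustion.2 ⟨g, hg, f, hf, rfl⟩
  rw [Finset.sum_congr rfl fun g hg => by rw [Finset.sum_singleton, if_pos (h1 g hg)]] at this
  simpa using this

-- A covering bound from below: a vertex `g⁻¹ • f` with `g` deep inside `I L` is also `(p⁻¹ * g)⁻¹ •
-- (p⁻¹ • f)` for each `p ∈ I m`, so at least `(I m).card` pairs reach it. The other vertices are at
-- most `F.card` times the elements outside the core.
open Classical in
theorem exists_card_mul_le_sum_translates (F : Finset V) (I : ℕ → Finset Γ) (m : ℕ)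
    (Q : Finset Γ) : ∃ Q' : Finset Γ, ∀ L, ∀ φ : V → ℝ, (∀ v, 0 ≤ φ v) → (∀ v, φ v ≤ 1) →
      (I m).card * (∑ v ∈ exhaustion F I L, φ v - F.card * (I L \ core Q' (I L)).card) ≤
        ∑ g ∈ core Q (I L), ∑ k ∈ exhaustion F I m, φ (g⁻¹ • k) := by
  -- This choice ensures that `p⁻¹ * g` is in `core Q (I L)` for every `p ∈ I m`.
  refine ⟨(I m)⁻¹ ∪ Q * (I m)⁻¹, fun L φ h0 h1 => ?_⟩
  set Q' := (I m)⁻¹ ∪ Q * (I m)⁻¹ with hQ'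
  set good := (exhaustion F I L).filter fun v => ∃ g ∈ core Q' (I L), ∃ f ∈ F, g⁻¹ • f = v
    with hgood
  have hbad : ∑ v ∈ exhaustion F I L, φ v - F.card * (I L \ core Q' (I L)).card ≤
      ∑ v ∈ good, φ v := by
    rw [← Finset.sum_filter_add_sum_filter_not (exhaustion F I L)
      (fun v => ∃ g ∈ core Q' (I L), ∃ f ∈ F, g⁻¹ • f = v) φ, sub_le_iff_le_add]
    refine add_le_add le_rfl ?_
    have hcard : ((exhaustion F I L).filter fun v =>
        ¬ ∃ g ∈ core Q' (I L), ∃ f ∈ F, g⁻¹ • f = v).card ≤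
        F.card * (I L \ core Q' (I L)).card := by
      rw [← Finset.card_product]
      refine (Finset.card_le_card ?_).trans
        (Finset.card_image_le (f := fun p : V × Γ => p.2⁻¹ • p.1))
      intro v hv
      rw [Finset.mem_filter, mem_exhaustion] at hv
      obtain ⟨⟨g, hg, f, hf, rfl⟩, hn⟩ := hv
      refine Finset.mem_image.2 ⟨(f, g), Finset.mem_product.2 ⟨hf, Finset.mem_sdiff.2 ⟨hg, ?_⟩⟩, rfl⟩
      exact fun hgc => hn ⟨g, hgc, f, hf, rfl⟩
    calc _ ≤ ∑ v ∈ (exhaustion F I L).filter fun v =>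
          ¬ ∃ g ∈ core Q' (I L), ∃ f ∈ F, g⁻¹ • f = v, (1 : ℝ) :=
          Finset.sum_le_sum fun v _ => h1 v
      _ ≤ _ := by
          rw [Finset.sum_const, nsmul_eq_mul, mul_one]
          exact_mod_cast hcard
  refine (mul_le_mul_of_nonneg_left hbad (Nat.cast_nonneg _)).trans ?_
  rw [← Finset.sum_product (f := fun p => φ (p.1⁻¹ • p.2)), Finset.mul_sum]
  rw [← Finset.sum_filter_add_sum_filter_not (core Q (I L) ×ˢ exhaustion F I m)
    (fun p => p.1⁻¹ • p.2 ∈ good)]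
  refine le_add_of_le_of_nonneg ?_ (Finset.sum_nonneg fun p _ => h0 _)
  rw [← Finset.sum_fiberwise_of_maps_to (g := fun p : Γ × V => p.1⁻¹ • p.2) (t := good)
    fun p hp => (Finset.mem_filter.1 hp).2]
  refine Finset.sum_le_sum fun v hv => ?_
  rw [Finset.sum_congr rfl (g := fun _ => φ v) fun p hp => by rw [(Finset.mem_filter.1 hp).2],
    Finset.sum_const, nsmul_eq_mul]
  refine mul_le_mul_of_nonneg_right ?_ (h0 v)
  obtain ⟨-, g, hg, f, hf, rfl⟩ := Finset.mem_filter.1 hv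
  rw [mem_core] at hg
  refine Nat.cast_le.2 (Finset.card_le_card_of_injOn (fun p => (p⁻¹ * g, p⁻¹ • f)) (fun p hp => ?_)
    fun p _ q _ hpq => ?_)
  · have hval : (p⁻¹ * g)⁻¹ • p⁻¹ • f = g⁻¹ • f := by
      rw [mul_inv_rev, inv_inv, mul_smul, smul_inv_smul]
    have hpi : p⁻¹ ∈ (I m)⁻¹ := Finset.inv_mem_inv hp
    simp only [Finset.coe_filter, Finset.mem_filter, Finset.mem_product, Set.mem_ofPred_eq, hval]
    refine ⟨⟨⟨mem_core.2 ⟨?_, fun q hq => ?_⟩, mem_exhaustion.2 ⟨p, hp, f, hf, rfl⟩⟩, hv⟩, trivial⟩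
    · exact hg.2 _ (Finset.mem_union_left _ hpi)
    · rw [← mul_assoc]
      exact hg.2 _ (Finset.mem_union_right _ (Finset.mul_mem_mul hq hpi))
  · simpa using congrArg Prod.fst hpq

-- By invariance the double neighbourhood of the box is covered by translates of that of `F`. A
-- translate by a core element stays in the box, so only elements outside the core contribute.
open Classical in
theorem exists_card_boundary_le {h : V → V → ℝ} (hfin : ∀ k, {j | h k j ≠ 0}.Finite)
    (hinv : ∀ (γ : Γ) k j, h (γ • k) (γ • j) = h k j) (hF : ∀ v : V, ∃ γ : Γ, γ • v ∈ F)
    (I : ℕ → Finset Γ) : ∃ (Q : Finset Γ) (c : ℕ), ∀ m,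
      (hoppingNbhd hfin (hoppingNbhd hfin (exhaustion F I m)) \ exhaustion F I m).card ≤
        c * (I m \ core Q (I m)).card := by
  set W := hoppingNbhd hfin (hoppingNbhd hfin F) with hW
  obtain ⟨Q, hQ⟩ := exists_core_translate_mem hF I W
  refine ⟨Q, W.card, fun m => ?_⟩
  rw [← Finset.card_product]
  refine (Finset.card_le_card ?_).trans (Finset.card_image_le (f := fun p : V × Γ => p.2⁻¹ • p.1))
  intro v hv
  obtain ⟨hv, hvm⟩ := Finset.mem_sdiff.1 hv
  have hv' : v ∈ (I m)⁻¹ • W := by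
    refine hoppingNbhd_smul_subset hfin hinv _ _ ?_
    have := smul_mem_hoppingNbhd hfin hinv (C := (I m)⁻¹ • hoppingNbhd hfin F) (1 : Γ)
      (fun k hk => by rw [one_smul]; exact hoppingNbhd_smul_subset hfin hinv _ _ hk) hv
    rwa [one_smul] at this
  obtain ⟨_, hg, w, hw, rfl⟩ := Finset.mem_smul.1 hv'
  obtain ⟨g, hg', rfl⟩ := Finset.mem_inv.1 hg
  refine Finset.mem_image.2 ⟨(w, g), Finset.mem_product.2 ⟨hw, Finset.mem_sdiff.2 ⟨hg', ?_⟩⟩, rfl⟩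
  exact fun hgc => hvm (hQ m g hgc w hw)

end Core

/-! ## Counting eigenvalues of the finite-volume restrictions -/

section Counting

variable {V Γ : Type*} [Group Γ] [MulAction Γ V] {h : V → V → ℝ} (hsymm : ∀ k j, h k j = h j k)
  {S : (V → ℝ≥0∞) → Set V}

-- The local estimate behind the upper bound. It applies `sum_sq_norm_le_card_add` on the space of
-- coefficients `c` of combinations of eigenvectors, the constraints being that the combination
-- vanishes on the translated collar of `B`.
open Classical in
theorem sum_siteEigenvector_translate_sq_le {hfin : ∀ k, {j | h k j ≠ 0}.Finite}
    (hinv : ∀ (γ : Γ) k j, h (γ • k) (γ • j) = h k j) (hS : IsSiteField Γ S)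
    {ω : V → ℝ≥0∞} {E s ε : ℝ} (hs : 0 < s) {B Λ : Finset V} {g : Γ}
    (hc : IsCoerciveOn hfin (shift g ω) (S (shift g ω)) E B s)
    (hg : ∀ b ∈ hoppingNbhd hfin B, g⁻¹ • b ∈ Λ)
    (T : Finset (sitesIn (S ω) Λ))
    (hT : ∀ i ∈ T, |siteEigenvalue hsymm ω (S ω) Λ i - E| ≤ ε) :
    ∑ k ∈ B, ∑ i ∈ T, siteEigenvector hsymm ω (S ω) Λ i (g⁻¹ • k) ^ 2 ≤
      (hoppingNbhd hfin (hoppingNbhd hfin B) \ B).card + s⁻¹ * (ε ^ 2 *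
        ∑ k ∈ hoppingNbhd hfin B, ∑ i ∈ T,
          siteEigenvector hsymm ω (S ω) Λ i (g⁻¹ • k) ^ 2) := by
  set u := siteEigenvector hsymm ω (S ω) Λ with hu
  set ev := siteEigenvalue hsymm ω (S ω) Λ with hev
  -- `a k` and `b k` represent evaluation at `g⁻¹ • k` of the combination and of its formal image
  -- under `H - E`.
  let a : V → EuclideanSpace ℝ (sitesIn (S ω) Λ) := fun k =>
    WithLp.toLp 2 fun i => if i ∈ T then u i (g⁻¹ • k) else 0
  let b : V → EuclideanSpace ℝ (sitesIn (S ω) Λ) := fun k =>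
    WithLp.toLp 2 fun i => if i ∈ T then (ev i - E) * u i (g⁻¹ • k) else 0
  let F : EuclideanSpace ℝ (sitesIn (S ω) Λ) → V → ℝ := fun c v => ∑ i ∈ T, c i * u i v
  have ha : ∀ k c, inner ℝ (a k) c = F c (g⁻¹ • k) := fun k c => by
    simp only [a, F, PiLp.inner_apply, RCLike.inner_apply, conj_trivial,
      mul_ite, mul_zero, Finset.sum_ite_mem, Finset.univ_inter]
  have hb : ∀ k c, inner ℝ (b k) c = ∑ i ∈ T, c i * ((ev i - E) * u i (g⁻¹ • k)) := fun k c => by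
    simp only [b, PiLp.inner_apply, RCLike.inner_apply, conj_trivial,
      mul_ite, mul_zero, Finset.sum_ite_mem, Finset.univ_inter]
  have hna : ∀ k, ‖a k‖ ^ 2 = ∑ i ∈ T, u i (g⁻¹ • k) ^ 2 := fun k => by
    rw [EuclideanSpace.norm_sq_eq]
    simp only [a, Real.norm_eq_abs, sq_abs, ite_pow, ne_eq, OfNat.ofNat_ne_zero, not_false_eq_true,
      zero_pow, Finset.sum_ite_mem, Finset.univ_inter]
  have hnb : ∀ k, ‖b k‖ ^ 2 ≤ ε ^ 2 * ∑ i ∈ T, u i (g⁻¹ • k) ^ 2 := fun k => by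
    rw [EuclideanSpace.norm_sq_eq]
    simp only [b, Real.norm_eq_abs, sq_abs, ite_pow, ne_eq, OfNat.ofNat_ne_zero, not_false_eq_true,
      zero_pow, Finset.sum_ite_mem, Finset.univ_inter]
    rw [Finset.mul_sum]
    refine Finset.sum_le_sum fun i hi => ?_
    rw [mul_pow, ← sq_abs (ev i - E)]
    have := hT i hi
    gcongr
  have hFsupp : ∀ c v, F c v ≠ 0 → v ∈ Λ ∧ v ∈ S ω := fun c v hv => by
    obtain ⟨i, -, hi⟩ := Finset.exists_ne_zero_of_sum_ne_zero hv
    exact mem_of_siteEigenvector_ne_zero (right_ne_zero_of_mul hi)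
  refine (sum_sq_norm_le_card_add B a (hoppingNbhd hfin B) b
    (hoppingNbhd hfin (hoppingNbhd hfin B) \ B) a hs ?_ ?_).trans' (by simp_rw [hna]; exact le_rfl)
    |>.trans ?_
  · intro c
    simp_rw [ha]
    calc ∑ k ∈ B, F c (g⁻¹ • k) ^ 2 = ∑ v ∈ B.image (g⁻¹ • ·), F c v ^ 2 :=
          (Finset.sum_image (f := fun v => F c v ^ 2) (MulAction.injective g⁻¹).injOn).symm
      _ ≤ ∑ v ∈ Λ, F c v ^ 2 := by
          refine Finset.sum_le_sum_of_subset_of_nonneg (fun v hv => ?_) fun v _ _ => sq_nonneg _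
          obtain ⟨k, hk, rfl⟩ := Finset.mem_image.1 hv
          exact hg k (subset_hoppingNbhd hfin B hk)
      _ = ∑ i, (if i ∈ T then c i else 0) ^ 2 := by
          rw [← sum_sq_sum_siteEigenvector hsymm ω (S ω) Λ]
          simp only [F, ite_mul, zero_mul, Finset.sum_ite_mem, Finset.univ_inter, hu]
      _ ≤ ‖c‖ ^ 2 := by
          rw [EuclideanSpace.norm_sq_eq]
          refine Finset.sum_le_sum fun i _ => ?_
          split_ifs
          · rw [Real.norm_eq_abs, sq_abs]
          · rw [zero_pow two_ne_zero]
            exact sq_nonneg ‖c i‖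
  · intro c hD
    simp_rw [ha] at hD ⊢
    simp_rw [hb]
    -- The combination cut off to the translate of `B`. The constraints make it agree with the
    -- combination on the double neighbourhood, so `H` acts equally on both at sites of the single
    -- neighbourhood.
    let f : V → ℝ := fun v => if g • v ∈ B then F c v else 0
    have hf : ∀ v, f v ≠ 0 → g • v ∈ B ∧ v ∈ S ω := fun v hv => by
      by_cases hgv : g • v ∈ B
      · simp only [f, if_pos hgv] at hv
        exact ⟨hgv, (hFsupp c v hv).2⟩
      · simp [f, hgv] at hv
    have hfF : ∀ w ∈ hoppingNbhd hfin (hoppingNbhd hfin B), f (g⁻¹ • w) = F c (g⁻¹ • w) := by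
      intro w hw
      by_cases hwB : w ∈ B
      · simp [f, hwB]
      · rw [hD w (Finset.mem_sdiff.2 ⟨hw, hwB⟩)]
        simp [f, hwB]
    have key := hc.of_shift hinv hS hf
    rw [Finset.sum_congr rfl fun k hk => by
      rw [hfF k (subset_hoppingNbhd hfin _ (subset_hoppingNbhd hfin B hk))]] at key
    refine key.trans (Finset.sum_le_sum fun k hk => ?_)
    by_cases hkS : g⁻¹ • k ∈ S ω
    · rw [Set.indicator_of_mem hkS]
      refine le_of_eq ?_
      have hk2 := hfF k (subset_hoppingNbhd hfin _ hk)
      have hop : energyOp h ω f (g⁻¹ • k) = energyOp h ω (F c) (g⁻¹ • k) := by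
        refine energyOp_congr hk2 fun j hj => ?_
        have := hfF (g • j) ((mem_hoppingNbhd hfin).2 (Or.inr ⟨k, hk, by
          rwa [← hinv g⁻¹, inv_smul_smul]⟩))
        rwa [inv_smul_smul] at this
      rw [hop, hk2, energyOp_sum hfin, Finset.mul_sum, ← Finset.sum_sub_distrib]
      congr 1
      refine Finset.sum_congr rfl fun i _ => ?_
      -- The eigenvalue equation holds only at sites of `Λ ∩ S ω`; hence the neighbourhood of the
      -- translate must lie in `Λ`.
      rw [energyOp_siteEigenvector hsymm ω (S ω) Λ i (hg k hk) hkS]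
      ring
    · rw [Set.indicator_of_notMem hkS]
      positivity
  · gcongr
    rw [Finset.mul_sum]
    exact Finset.sum_le_sum fun k _ => hnb k

open Classical in
theorem sum_exhaustion_sum_siteEigenvector_sq (ω : V → ℝ≥0∞) (S : Set V) (Λ : Finset V)
    (T : Finset (sitesIn S Λ)) :
    ∑ v ∈ Λ, ∑ i ∈ T, siteEigenvector hsymm ω S Λ i v ^ 2 = T.card := by
  rw [Finset.sum_comm]
  simp_rw [sum_siteEigenvector_sq]
  simp

theorem sum_subset_siteEigenvector_sq_le_one (ω : V → ℝ≥0∞) (S : Set V) (Λ : Finset V)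
    (T : Finset (sitesIn S Λ)) (v : V) :
    ∑ i ∈ T, siteEigenvector hsymm ω S Λ i v ^ 2 ≤ 1 :=
  (Finset.sum_le_sum_of_subset_of_nonneg (Finset.subset_univ T) fun _ _ _ => sq_nonneg _).trans
    (sum_siteEigenvector_sq_le_one hsymm ω S Λ v)

theorem mem_of_sum_siteEigenvector_sq_ne_zero {ω : V → ℝ≥0∞} {S : Set V} {Λ : Finset V}
    {T : Finset (sitesIn S Λ)} {v : V}
    (hv : ∑ i ∈ T, siteEigenvector hsymm ω S Λ i v ^ 2 ≠ 0) : v ∈ Λ := by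
  obtain ⟨i, -, hi⟩ := Finset.exists_ne_zero_of_sum_ne_zero hv
  exact (mem_of_siteEigenvector_ne_zero (pow_ne_zero_iff two_ne_zero |>.1 hi)).1

open Classical in
/-- Upper bound for the number of eigenvalues near `E`, by the number of translates of a box on
which the Hamiltonian minus `E` is not coercive. -/
theorem exists_card_eigenvalues_le {hfin : ∀ k, {j | h k j ≠ 0}.Finite}
    (hinv : ∀ (γ : Γ) k j, h (γ • k) (γ • j) = h k j)
    (hS : IsSiteField Γ S) (hstab : ∀ v : V, Finite (MulAction.stabilizer Γ v))
    {F : Finset V} (hF : ∀ v : V, ∃ γ : Γ, γ • v ∈ F) (I : ℕ → Finset Γ) (m : ℕ) (E : ℝ) :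
    ∃ (Q Q' : Finset Γ) (M : ℕ), ∀ (s ε : ℝ), 0 < s → ∀ (L : ℕ) (ω : V → ℝ≥0∞)
      (T : Finset (sitesIn (S ω) (exhaustion F I L))),
      (∀ i ∈ T, |siteEigenvalue hsymm ω (S ω) (exhaustion F I L) i - E| ≤ ε) →
      (I m).card * ((T.card : ℝ) - F.card * (I L \ core Q' (I L)).card) ≤
        (I L).card * (hoppingNbhd hfin (hoppingNbhd hfin (exhaustion F I m)) \
          exhaustion F I m).card + s⁻¹ * (ε ^ 2 * (M * T.card)) +
        (exhaustion F I m).card * ((core Q (I L)).filter fun g => ¬ IsCoerciveOn hfin (shift g ω)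
          (S (shift g ω)) E (exhaustion F I m) s).card := by
  set B := exhaustion F I m with hB
  obtain ⟨Q, hQ⟩ := exists_core_translate_mem hF I (hoppingNbhd hfin B)
  obtain ⟨Q', hQ'⟩ := exists_card_mul_le_sum_translates F I m Q
  obtain ⟨M, hM⟩ := exists_card_translates_le hstab (hoppingNbhd hfin B)
  refine ⟨Q, Q', M, fun s ε hs L ω => ?_⟩
  set Λ := exhaustion F I L with hΛ
  intro T hT
  set D := (hoppingNbhd hfin (hoppingNbhd hfin B) \ B).card with hD
  set φ : V → ℝ := fun v => ∑ i ∈ T, siteEigenvector hsymm ω (S ω) Λ i v ^ 2 with hφ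
  have hφ0 : ∀ v, 0 ≤ φ v := fun v => Finset.sum_nonneg fun i _ => sq_nonneg _
  have hφ1 : ∀ v, φ v ≤ 1 := sum_subset_siteEigenvector_sq_le_one hsymm ω (S ω) Λ T
  have hsum : ∑ v ∈ Λ, φ v = T.card := sum_exhaustion_sum_siteEigenvector_sq hsymm ω (S ω) Λ T
  have hlow := hQ' L φ hφ0 hφ1
  rw [hsum] at hlow
  have hup := sum_translates_le hM (core Q (I L)) Λ hφ0
    (fun v hv => mem_of_sum_siteEigenvector_sq_ne_zero hsymm hv)
  rw [hsum] at hup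
  have hterm : ∀ g ∈ core Q (I L), ∑ k ∈ B, φ (g⁻¹ • k) ≤
      (D : ℝ) + s⁻¹ * (ε ^ 2 * ∑ k ∈ hoppingNbhd hfin B, φ (g⁻¹ • k)) +
        if ¬ IsCoerciveOn hfin (shift g ω) (S (shift g ω)) E B s then (B.card : ℝ) else 0 := by
    intro g hg
    -- Translates without coercivity get the trivial bound of mass 1 per site.
    by_cases hc : IsCoerciveOn hfin (shift g ω) (S (shift g ω)) E B s
    · rw [if_neg (not_not.2 hc), add_zero]
      exact sum_siteEigenvector_translate_sq_le hsymm hinv hS hs hc (hQ L g hg) T hT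
    · rw [if_pos hc]
      refine le_add_of_nonneg_of_le ?_ ?_
      · have : 0 ≤ ∑ k ∈ hoppingNbhd hfin B, φ (g⁻¹ • k) := Finset.sum_nonneg fun k _ => hφ0 _
        positivity
      · exact (Finset.sum_le_sum fun k _ => hφ1 _).trans (by simp)
  refine hlow.trans ((Finset.sum_le_sum hterm).trans ?_)
  rw [Finset.sum_add_distrib, Finset.sum_add_distrib, ← Finset.mul_sum, ← Finset.mul_sum,
    ← Finset.sum_filter, Finset.sum_const, Finset.sum_const, nsmul_eq_mul, nsmul_eq_mul,
    mul_comm _ (B.card : ℝ)]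
  have hcard : ((core Q (I L)).card : ℝ) ≤ (I L).card := by
    exact_mod_cast Finset.card_le_card (core_subset Q (I L))
  gcongr

open Classical in
/-- Lower bound for the multiplicity of `E`, by the number of translates of a finite set that
support an eigenfunction. -/
theorem exists_card_eigenfunctions_le
    (hinv : ∀ (γ : Γ) k j, h (γ • k) (γ • j) = h k j)
    (hS : IsSiteField Γ S) (hstab : ∀ v : V, Finite (MulAction.stabilizer Γ v))
    {F : Finset V} (hF : ∀ v : V, ∃ γ : Γ, γ • v ∈ F) (I : ℕ → Finset Γ) (B : Finset V) (E : ℝ) :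
    ∃ (Q : Finset Γ) (M : ℕ), ∀ (L : ℕ) (ω : V → ℝ≥0∞),
      (((core Q (I L)).filter fun g =>
        HasEigenfunctionOn h (shift g ω) (S (shift g ω)) E B).card : ℝ) ≤
        M * (Finset.univ.filter fun i =>
          siteEigenvalue hsymm ω (S ω) (exhaustion F I L) i = E).card := by
  obtain ⟨Q, hQ⟩ := exists_core_translate_mem hF I B
  obtain ⟨M, hM⟩ := exists_card_translates_le hstab B
  refine ⟨Q, M, fun L ω => ?_⟩
  set Λ := exhaustion F I L with hΛ
  set T := Finset.univ.filter fun i => siteEigenvalue hsymm ω (S ω) Λ i = E with hT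
  set J := (core Q (I L)).filter fun g => HasEigenfunctionOn h (shift g ω) (S (shift g ω)) E B
    with hJ
  have hup := sum_translates_le hM J Λ
    (φ := fun v => ∑ i ∈ T, siteEigenvector hsymm ω (S ω) Λ i v ^ 2)
    (fun v => Finset.sum_nonneg fun i _ => sq_nonneg _)
    (fun v hv => mem_of_sum_siteEigenvector_sq_ne_zero hsymm hv)
  rw [sum_exhaustion_sum_siteEigenvector_sq] at hup
  refine le_trans ?_ hup
  rw [Finset.card_eq_sum_ones, Nat.cast_sum]
  refine Finset.sum_le_sum fun g hg => ?_
  obtain ⟨hgc, hg⟩ := Finset.mem_filter.1 hg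
  obtain ⟨f, hne, hsupp, heq⟩ := hg.of_shift hinv hS
  have := one_le_sum_siteEigenvector_sq hsymm ω (S ω) Λ (C := B.image (g⁻¹ • ·))
    (fun v hv => by
      obtain ⟨k, hk, rfl⟩ := Finset.mem_image.1 hv
      exact hQ L g hgc k hk) hne
    (fun v hv => ⟨Finset.mem_image.2 ⟨g • v, (hsupp v hv).1, inv_smul_smul _ _⟩, (hsupp v hv).2⟩)
    heq
  rw [Finset.sum_image (MulAction.injective g⁻¹).injOn] at this
  rw [Nat.cast_one]
  exact this

end Counting

/-! ## Discontinuities of monotone functions -/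

theorem exists_jump_of_not_continuousAt {N : ℝ → ℝ} (hN : Monotone N) {E : ℝ}
    (hE : ¬ ContinuousAt N E) : ∃ c > 0, ∀ a b, a < E → E < b → c ≤ N b - N a := by
  by_contra! hcon
  refine hE (Metric.continuousAt_iff'.2 fun ε hε => ?_)
  obtain ⟨a, b, ha, hb, hab⟩ := hcon ε hε
  filter_upwards [Ioo_mem_nhds ha hb] with x hx
  have h1 := hN hx.1.le
  have h2 := hN hx.2.le
  have h3 := hN ha.le
  have h4 := hN hb.le
  rw [Real.dist_eq, abs_lt]
  constructor <;> linarith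

theorem exists_continuousAt_between {N : ℝ → ℝ} (hN : Monotone N) {a b : ℝ} (hab : a < b) :
    ∃ x, ContinuousAt N x ∧ a < x ∧ x < b := by
  obtain ⟨x, hx, hax, hxb⟩ :=
    (hN.countable_not_continuousAt.dense_compl ℝ).exists_between hab
  exact ⟨x, not_not.1 hx, hax, hxb⟩

theorem exists_sub_lt_of_continuousAt {N : ℝ → ℝ} (hN : Monotone N) {E : ℝ}
    (hE : ContinuousAt N E) {η : ℝ} (hη : 0 < η) : ∃ a b, a < E ∧ E < b ∧ ContinuousAt N a ∧
      ContinuousAt N b ∧ N b - N a < η := by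
  obtain ⟨δ, hδ, hball⟩ := Metric.continuousAt_iff.1 hE (η / 2) (by positivity)
  obtain ⟨a, ha, ha1, ha2⟩ := exists_continuousAt_between hN (show E - δ < E by linarith)
  obtain ⟨b, hb, hb1, hb2⟩ := exists_continuousAt_between hN (show E < E + δ by linarith)
  refine ⟨a, b, ha2, hb1, ha, hb, ?_⟩
  have h1 := hball (x := a) (by rw [Real.dist_eq, abs_lt]; constructor <;> linarith)
  have h2 := hball (x := b) (by rw [Real.dist_eq, abs_lt]; constructor <;> linarith)
  rw [Real.dist_eq, abs_lt] at h1 h2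
  linarith [h1.1, h2.2]

/-! ## Frequencies of events along the exhaustion -/

/-- By invariance the expected frequency is at most `P A`, and Fatou's lemma passes an almost sure
eventual lower bound to the expectation. Upper bounds on frequencies are used through complements.
-/
theorem le_measure_of_eventually_le_card {V Γ : Type*} [Group Γ] [MulAction Γ V]
    {P : Measure (V → ℝ≥0∞)} [IsProbabilityMeasure P] (hP : IsErgodicField Γ P)
    {A : Set (V → ℝ≥0∞)} [∀ ω, DecidablePred fun g : Γ => shift g ω ∈ A]
    (hA : MeasurableSet A) {I J : ℕ → Finset Γ}
    (hI : ∀ L, (I L).Nonempty) (hJ : ∀ L, J L ⊆ I L) {b : ℝ}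
    (hb : ∀ᵐ ω ∂P, ∀ᶠ L in atTop,
      b * (I L).card ≤ ((J L).filter fun g => shift g ω ∈ A).card) :
    ENNReal.ofReal b ≤ P A := by
  classical
  let φ : ℕ → (V → ℝ≥0∞) → ℝ≥0∞ := fun L ω =>
    ((I L).card : ℝ≥0∞)⁻¹ * ∑ g ∈ J L, (shift g ⁻¹' A).indicator 1 ω
  have hmeasA : ∀ g : Γ, MeasurableSet (shift (V := V) g ⁻¹' A) := fun g =>
    (hP.measurePreserving g).measurable hA
  have hφm : ∀ L, Measurable (φ L) := fun L => by
    refine Measurable.const_mul (Finset.measurable_sum _ fun g _ => ?_) _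
    exact measurable_one.indicator (hmeasA g)
  have hI0 : ∀ L, ((I L).card : ℝ≥0∞) ≠ 0 := fun L => by
    exact_mod_cast (hI L).card_pos.ne'
  have hφint : ∀ L, ∫⁻ ω, φ L ω ∂P ≤ P A := fun L => by
    simp only [φ]
    rw [lintegral_const_mul _ (Finset.measurable_sum _ fun g _ =>
        measurable_one.indicator (hmeasA g)),
      lintegral_finsetSum _ fun g _ => measurable_one.indicator (hmeasA g)]
    simp_rw [lintegral_indicator_one (hmeasA _)]
    rw [Finset.sum_congr rfl fun g _ => (hP.measurePreserving g).measure_preimage hA.nullMeasurableSet,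
      Finset.sum_const, nsmul_eq_mul]
    calc ((I L).card : ℝ≥0∞)⁻¹ * ((J L).card * P A)
        ≤ ((I L).card : ℝ≥0∞)⁻¹ * ((I L).card * P A) := by
          gcongr
          exact hJ L
      _ = P A := by
          rw [← mul_assoc, ENNReal.inv_mul_cancel (hI0 L) (ENNReal.natCast_ne_top _), one_mul]
  have hlow : ∀ᵐ ω ∂P, ENNReal.ofReal b ≤ liminf (fun L => φ L ω) atTop := by
    filter_upwards [hb] with ω hω
    refine le_liminf_of_le (by isBoundedDefault) ?_
    filter_upwards [hω] with L hL
    have hcard : ∑ g ∈ J L, (shift g ⁻¹' A).indicator (1 : (V → ℝ≥0∞) → ℝ≥0∞) ω =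
        ((J L).filter fun g => shift g ω ∈ A).card := by
      simp only [Set.indicator_apply, Set.mem_preimage, Pi.one_apply]
      rw [Finset.sum_boole]
    simp only [φ, hcard]
    rw [← ENNReal.div_eq_inv_mul, ENNReal.le_div_iff_mul_le (Or.inl (hI0 L))
      (Or.inl (ENNReal.natCast_ne_top _)), ← ENNReal.ofReal_natCast, ← ENNReal.ofReal_natCast,
      ← ENNReal.ofReal_mul' (Nat.cast_nonneg _)]
    exact ENNReal.ofReal_le_ofReal hL
  calc ENNReal.ofReal b = ∫⁻ _, ENNReal.ofReal b ∂P := by simp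
    _ ≤ ∫⁻ ω, liminf (fun L => φ L ω) atTop ∂P := lintegral_mono_ae hlow
    _ ≤ liminf (fun L => ∫⁻ ω, φ L ω ∂P) atTop := lintegral_liminf_le hφm
    _ ≤ P A := (liminf_le_liminf (Eventually.of_forall hφint)).trans_eq (liminf_const _)

/-! ## Discontinuities of the integrated density of states -/

section IDS

variable {V Γ : Type*} [Group Γ] [MulAction Γ V] {h : V → V → ℝ} {S : (V → ℝ≥0∞) → Set V}

theorem IsCoerciveOn.mono {hfin : ∀ k, {j | h k j ≠ 0}.Finite} {ω : V → ℝ≥0∞} {S : Set V}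
    {E : ℝ} {B : Finset V} {s t : ℝ} (hc : IsCoerciveOn hfin ω S E B s) (hts : t ≤ s) :
    IsCoerciveOn hfin ω S E B t := fun f =>
  (mul_le_mul_of_nonneg_right hts (Finset.sum_nonneg fun _ _ => sq_nonneg _)).trans (hc f)

/-- The failure events decrease as the constant tends to 0, with null intersection, so continuity
from above applies. -/
theorem exists_measure_not_isCoerciveOn_lt [Countable V] (hsymm : ∀ k j, h k j = h j k)
    (hfin : ∀ k, {j | h k j ≠ 0}.Finite) (hS : IsSiteField Γ S)
    {P : Measure (V → ℝ≥0∞)} [IsProbabilityMeasure P] {E : ℝ} (B : Finset V)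
    (hE : ∀ᵐ ω ∂P, ¬ HasEigenfunctionOn h ω (S ω) E B) {δ : ℝ≥0∞} (hδ : 0 < δ) :
    ∃ s : ℝ, 0 < s ∧ P {ω | ¬ IsCoerciveOn hfin ω (S ω) E B s} < δ := by
  have hlim := tendsto_measure_iInter_atTop (μ := P)
    (s := fun n : ℕ => {ω | ¬ IsCoerciveOn hfin ω (S ω) E B ((n : ℝ) + 1)⁻¹})
    (fun n => (measurableSet_isCoerciveOn hfin hS E B _).compl.nullMeasurableSet)
    (fun n m hnm ω hω hc => hω (hc.mono (by gcongr))) ⟨0, measure_ne_top _ _⟩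
  have hzero : P (⋂ n : ℕ, {ω | ¬ IsCoerciveOn hfin ω (S ω) E B ((n : ℝ) + 1)⁻¹}) = 0 := by
    refine measure_mono_null (fun ω hω => ?_) (ae_iff.1 hE)
    intro hn
    obtain ⟨n, hn⟩ := exists_isCoerciveOn hsymm hfin hn
    exact Set.mem_iInter.1 hω n hn
  rw [hzero] at hlim
  obtain ⟨n, hn⟩ := (hlim.eventually (gt_mem_nhds hδ)).exists
  exact ⟨((n : ℝ) + 1)⁻¹, by positivity, hn⟩

open Classical in
theorem countingFunction_sub (hsymm : ∀ k j, h k j = h j k) (ω : V → ℝ≥0∞) (S : Set V)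
    (Λ : Finset V) {a b : ℝ} (hab : a ≤ b) :
    countingFunction hsymm ω S Λ b - countingFunction hsymm ω S Λ a =
      ((Finset.univ.filter fun i => a ≤ siteEigenvalue hsymm ω S Λ i ∧
        siteEigenvalue hsymm ω S Λ i < b).card : ℝ) / Λ.card := by
  rw [countingFunction_eq, countingFunction_eq, ← sub_div]
  congr 1
  rw [sub_eq_iff_eq_add, ← Nat.cast_add, ← Finset.card_union_of_disjoint]
  · congr 2
    ext i
    simp only [Finset.mem_filter, Finset.mem_univ, true_and, Finset.mem_union]
    constructor
    · intro hi
      rcases le_or_gt a (siteEigenvalue hsymm ω S Λ i) with hai | hai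
      · exact Or.inl ⟨hai, hi⟩
      · exact Or.inr hai
    · rintro (hi | hi)
      · exact hi.2
      · exact hi.trans_le hab
  · refine Finset.disjoint_filter.2 fun i _ hi => ?_
    exact not_lt.2 hi.1

theorem card_le_of_subset_sitesIn (S : Set V) (Λ : Finset V) (T : Finset (sitesIn S Λ)) : T.card ≤ Λ.card := by
  classical
  refine (Finset.card_le_univ T).trans ?_
  rw [Fintype.card_coe]
  exact Finset.card_filter_le _ _

theorem multiplicity_upper_bound {f M p η l v t : ℝ} (hf : 0 ≤ f) (hM : 0 ≤ M) (hp : 0 ≤ p)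
    (hη : η = p / (4 * (M * f + 1))) (hl : 0 ≤ l) (ht : t ≤ η * v) (hv : v ≤ f * l) :
    M * t ≤ p / 4 * l := by
  have hMf : 0 ≤ M * f := mul_nonneg hM hf
  have hη0 : 0 ≤ η := by rw [hη]; positivity
  have hηp : η * (M * f + 1) = p / 4 := by rw [hη]; field_simp
  calc M * t ≤ M * (η * (f * l)) := by gcongr; exact ht.trans (by gcongr)
    _ = η * (M * f) * l := by ring
    _ ≤ η * (M * f + 1) * l := by gcongr; linarith
    _ = p / 4 * l := by rw [hηp]

/-- Bookkeeping: `f`, `m`, `l`, `b` are the sizes of `F`, `I m`, `I L` and the small box, `t` counts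
eigenvalues, `x` elements outside the core, `d` collar sites. The three error terms cost `c / 8`
each, which leaves `5 / 8 * c = 5 * δ * (f + 1)`. -/
theorem frequency_lower_bound {f M bad s c δ ε m l t x d b : ℝ} (hf : 0 ≤ f) (hM : 0 ≤ M)
    (hbad : 0 ≤ bad) (hs : 0 < s) (hc : 0 < c) (hδ : δ = c / (8 * (f + 1)))
    (hε : ε ^ 2 = c * s / (8 * (M * f + 1))) (hm : 1 ≤ m) (hl : 0 ≤ l)
    (htlow : c * l ≤ t) (htup : t ≤ f * l) (hx : x ≤ δ * l) (hb : b ≤ f * m)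
    (hd : d ≤ c / 8 * m)
    (hmain : m * (t - f * x) ≤ l * d + s⁻¹ * (ε ^ 2 * (M * t)) + b * bad) :
    5 * δ * l ≤ bad := by
  have hm0 : 0 < m := by linarith
  have hMf : 0 ≤ M * f := mul_nonneg hM hf
  have hδc : δ * (8 * (f + 1)) = c := by rw [hδ]; field_simp
  have hδ0 : 0 ≤ δ := by rw [hδ]; positivity
  have hterm1 : f * x ≤ c / 8 * l := by
    calc f * x ≤ f * (δ * l) := by gcongr
      _ ≤ (f + 1) * (δ * l) := by gcongr; linarith
      _ = δ * (8 * (f + 1)) / 8 * l := by ring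
      _ = c / 8 * l := by rw [hδc]
  have hterm2 : s⁻¹ * (ε ^ 2 * (M * t)) ≤ c / 8 * l * m := by
    calc s⁻¹ * (ε ^ 2 * (M * t)) ≤ s⁻¹ * (ε ^ 2 * (M * (f * l))) := by gcongr
      _ = s⁻¹ * ε ^ 2 * (M * f) * l := by ring
      _ ≤ s⁻¹ * ε ^ 2 * (M * f + 1) * l := by gcongr; linarith
      _ = c / 8 * l * 1 := by rw [hε]; field_simp
      _ ≤ _ := by gcongr
  have h1 : m * (7 / 8 * c * l) ≤ m * (t - f * x) := by
    gcongr
    linarith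
  have h2 : l * d ≤ l * (c / 8 * m) := by gcongr
  have h3 : b * bad ≤ f * m * bad := by gcongr
  have hprod : m * (5 / 8 * c * l) ≤ m * (f * bad) := by linarith
  have hfin := le_of_mul_le_mul_left hprod hm0
  refine le_of_mul_le_mul_left (a := f + 1) ?_ (by positivity)
  calc (f + 1) * (5 * δ * l) = 5 / 8 * (δ * (8 * (f + 1))) * l := by ring
    _ = 5 / 8 * c * l := by rw [hδc]
    _ ≤ f * bad := hfin
    _ ≤ (f + 1) * bad := by gcongr; linarith

theorem not_mem_almostSureSigmaFin_of_continuousAt [Countable V] [Nonempty V]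
    (hsymm : ∀ k j, h k j = h j k) (hfin : ∀ k, {j | h k j ≠ 0}.Finite)
    (hinv : ∀ (γ : Γ) k j, h (γ • k) (γ • j) = h k j)
    (hS : IsSiteField Γ S) (hstab : ∀ v : V, Finite (MulAction.stabilizer Γ v))
    {F : Finset V} (hF : ∀ v : V, ∃ γ : Γ, γ • v ∈ F) {I : ℕ → Finset Γ} (hI : IsFolnerSequence I)
    {P : Measure (V → ℝ≥0∞)} [IsProbabilityMeasure P] (hP : IsErgodicField Γ P) {E : ℝ}
    {N : ℝ → ℝ} (hN : IsIDS hsymm P S (exhaustion F I) N) (hcont : ContinuousAt N E) :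
    E ∉ almostSureSigmaFin h P S := by
  classical
  intro hE
  have hE' : ∀ᵐ ω ∂P, E ∈ sigmaFin h ω (S ω) := hE
  -- There are countably many `B`, so one of them supports an eigenfunction with positive
  -- probability.
  obtain ⟨B, hB⟩ : ∃ B : Finset V, P {ω | HasEigenfunctionOn h ω (S ω) E B} ≠ 0 := by
    by_contra! hall
    have hnull : ∀ᵐ ω ∂P, ∀ B : Finset V, ¬ HasEigenfunctionOn h ω (S ω) E B :=
      ae_all_iff.2 fun B => by rw [ae_iff]; simpa using hall B
    obtain ⟨ω, hω, hω'⟩ := (hE'.and hnull).exists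
    obtain ⟨B, hB⟩ := (mem_sigmaFin_iff hfin).1 hω
    exact hω' B hB
  set A := {ω | HasEigenfunctionOn h ω (S ω) E B} with hA
  have hAm : MeasurableSet A := measurableSet_hasEigenfunctionOn hsymm hfin hS E B
  set p := P.real A with hp
  have hp0 : 0 < p := ENNReal.toReal_pos hB (measure_ne_top _ _)
  obtain ⟨Q, M, hQM⟩ := exists_card_eigenfunctions_le hsymm hinv hS hstab hF I B E
  set η := p / (4 * (M * F.card + 1)) with hη
  have hη0 : 0 < η := by positivity
  obtain ⟨a, b, ha, hb, hca, hcb, hab⟩ := exists_sub_lt_of_continuousAt hN.monotone hcont hη0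
  -- Elements outside the core and translates with an eigenfunction each cost at most a fraction `p
  -- / 4`. The resulting bound contradicts `P Aᶜ = 1 - p`.
  have hfreq : ∀ᵐ ω ∂P, ∀ᶠ L in atTop, (1 - p / 2) * (I L).card ≤
      ((core Q (I L)).filter fun g => shift g ω ∈ Aᶜ).card := by
    filter_upwards [hN.tendsto] with ω hω
    have hdiff := ((hω b hcb).sub (hω a hca)).eventually (gt_mem_nhds hab)
    filter_upwards [hdiff, hI.eventually_card_sdiff_core_le Q (show 0 < p / 4 by positivity)]
      with L hL hcore
    rw [countingFunction_sub _ _ _ _ (ha.trans hb).le] at hL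
    set Λ := exhaustion F I L with hΛ
    set T := Finset.univ.filter fun i => siteEigenvalue hsymm ω (S ω) Λ i = E with hT
    have hΛI : (Λ.card : ℝ) ≤ F.card * (I L).card := by exact_mod_cast card_exhaustion_le F I L
    have hTΛ : (T.card : ℝ) ≤ η * Λ.card := by
      -- For an empty box the quotient is 0 by convention and says nothing, but then there are no
      -- eigenvalues.
      rcases Nat.eq_zero_or_pos Λ.card with h0 | hpos
      · have := card_le_of_subset_sitesIn (S ω) Λ T
        rw [h0, Nat.le_zero] at this
        rw [h0, this]; simp
      · rw [div_lt_iff₀ (by exact_mod_cast hpos)] at hL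
        refine le_trans ?_ hL.le
        refine Nat.cast_le.2 (Finset.card_le_card fun i hi => ?_)
        have hi := (Finset.mem_filter.1 hi).2
        exact Finset.mem_filter.2 ⟨Finset.mem_univ _, by rw [hi]; exact ha.le, by rw [hi]; exact hb⟩
    have hMT : (((core Q (I L)).filter fun g => shift g ω ∈ A).card : ℝ) ≤ M * T.card := hQM L ω
    have hsplit : (((core Q (I L)).filter fun g => shift g ω ∈ A).card : ℝ) +
        ((core Q (I L)).filter fun g => shift g ω ∈ Aᶜ).card = (core Q (I L)).card := by
      exact_mod_cast Finset.card_filter_add_card_filter_not (s := core Q (I L))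
        (fun g => shift g ω ∈ A)
    have hcard : ((I L \ core Q (I L)).card : ℝ) + (core Q (I L)).card = (I L).card := by
      exact_mod_cast Finset.card_sdiff_add_card_eq_card (core_subset Q (I L))
    have hMT' := multiplicity_upper_bound (Nat.cast_nonneg F.card) (Nat.cast_nonneg M) hp0.le hη
      (Nat.cast_nonneg _) hTΛ hΛI
    linarith
  have hle := le_measure_of_eventually_le_card hP hAm.compl hI.nonempty
    (fun L => core_subset Q (I L)) hfreq
  rw [ENNReal.ofReal_le_iff_le_toReal (measure_ne_top _ _)] at hle
  have hcompl : (P Aᶜ).toReal = 1 - p := probReal_compl_eq_one_sub hAm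
  rw [hcompl] at hle
  linarith

theorem mem_almostSureSigmaFin_of_not_continuousAt [Countable V] [Nonempty V]
    (hsymm : ∀ k j, h k j = h j k) (hfin : ∀ k, {j | h k j ≠ 0}.Finite)
    (hinv : ∀ (γ : Γ) k j, h (γ • k) (γ • j) = h k j)
    (hS : IsSiteField Γ S) (hstab : ∀ v : V, Finite (MulAction.stabilizer Γ v))
    {F : Finset V} (hF : ∀ v : V, ∃ γ : Γ, γ • v ∈ F) {I : ℕ → Finset Γ} (hI : IsFolnerSequence I)
    {P : Measure (V → ℝ≥0∞)} [IsProbabilityMeasure P] (hP : IsErgodicField Γ P) {E : ℝ}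
    {N : ℝ → ℝ} (hN : IsIDS hsymm P S (exhaustion F I) N) (hcont : ¬ ContinuousAt N E) :
    E ∈ almostSureSigmaFin h P S := by
  classical
  refine (mem_almostSureSigmaFin_or hsymm hfin hinv hS hP E).resolve_right fun hnot => ?_
  obtain ⟨c, hc0, hc⟩ := exists_jump_of_not_continuousAt hN.monotone hcont
  have hFne : F.Nonempty := by
    obtain ⟨v⟩ := ‹Nonempty V›
    obtain ⟨γ, hγ⟩ := hF v
    exact ⟨_, hγ⟩
  have hI0 : ∀ L, (0 : ℝ) < (I L).card := fun L => by exact_mod_cast (hI.nonempty L).card_pos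
  obtain ⟨C, hC⟩ := exists_card_le_mul_card_exhaustion hstab hFne I
  -- A jump `c` yields eventually more than `c / 2 * Λ.card` eigenvalues near `E`, hence at least
  -- `c' * (I L).card`. The choices that follow depend on each other in order: the box index `m`,
  -- then `s` for that box, then the energy window `ε`.
  set c' := c / (2 * (C + 1)) with hc'
  have hc'0 : 0 < c' := by positivity
  obtain ⟨Qb, cb, hbd⟩ := exists_card_boundary_le hfin hinv hF I
  obtain ⟨m, hm⟩ := (hI.eventually_card_sdiff_core_le Qb
    (show 0 < c' / (8 * (cb + 1)) by positivity)).exists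
  set D := (hoppingNbhd hfin (hoppingNbhd hfin (exhaustion F I m)) \ exhaustion F I m).card with hD
  have hDm : (D : ℝ) ≤ c' / 8 * (I m).card := by
    calc (D : ℝ) ≤ cb * (I m \ core Qb (I m)).card := by exact_mod_cast hbd m
      _ ≤ (cb + 1) * (c' / (8 * (cb + 1)) * (I m).card) := by gcongr; linarith
      _ = c' / 8 * (I m).card := by field_simp
  obtain ⟨Q, Q', M, hcount⟩ := exists_card_eigenvalues_le (hfin := hfin) hsymm hinv hS hstab hF I m E
  set δ := c' / (8 * (F.card + 1)) with hδ
  have hδ0 : 0 < δ := by positivity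
  obtain ⟨s, hs0, hs⟩ := exists_measure_not_isCoerciveOn_lt hsymm hfin hS (P := P) (E := E)
    (exhaustion F I m)
    (hnot.mono fun ω hω hB => hω ((mem_sigmaFin_iff hfin).2 ⟨_, hB⟩))
    (ENNReal.ofReal_pos.2 hδ0)
  set ε := √(c' * s / (8 * (M * F.card + 1))) with hε
  have hε0 : 0 < ε := Real.sqrt_pos.2 (by positivity)
  have hε2 : ε ^ 2 = c' * s / (8 * (M * F.card + 1)) := Real.sq_sqrt (by positivity)
  obtain ⟨a, hca, ha1, ha2⟩ := exists_continuousAt_between hN.monotone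
    (show E - ε < E by linarith)
  obtain ⟨b, hcb, hb1, hb2⟩ := exists_continuousAt_between hN.monotone
    (show E < E + ε by linarith)
  -- Non-coercive translates have frequency at least `5 * δ`, while `s` was chosen so that
  -- non-coercivity has probability below `δ`.
  have hfreq : ∀ᵐ ω ∂P, ∀ᶠ L in atTop, (5 * δ) * (I L).card ≤
      ((core Q (I L)).filter fun g => shift g ω ∈
        {ω | ¬ IsCoerciveOn hfin ω (S ω) E (exhaustion F I m) s}).card := by
    filter_upwards [hN.tendsto] with ω hω
    have hdiff := ((hω b hcb).sub (hω a hca)).eventually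
      (lt_mem_nhds (show c / 2 < N b - N a by linarith [hc a b ha2 hb1]))
    filter_upwards [hdiff, hI.eventually_card_sdiff_core_le Q' hδ0] with L hL hcore
    rw [countingFunction_sub _ _ _ _ (ha2.trans hb1).le] at hL
    set Λ := exhaustion F I L with hΛ
    set T := Finset.univ.filter fun i => a ≤ siteEigenvalue hsymm ω (S ω) Λ i ∧
      siteEigenvalue hsymm ω (S ω) Λ i < b with hT
    set bad := ((core Q (I L)).filter fun g => shift g ω ∈
        {ω | ¬ IsCoerciveOn hfin ω (S ω) E (exhaustion F I m) s}).card with hbad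
    have hΛI : (Λ.card : ℝ) ≤ F.card * (I L).card := by exact_mod_cast card_exhaustion_le F I L
    have hBI : ((exhaustion F I m).card : ℝ) ≤ F.card * (I m).card := by
      exact_mod_cast card_exhaustion_le F I m
    have hΛ0 : (0 : ℝ) < Λ.card := by
      by_contra hle
      have := hC L
      have h0 : (Λ.card : ℝ) = 0 := le_antisymm (not_lt.1 hle) (Nat.cast_nonneg _)
      rw [← hΛ, h0, mul_zero] at this
      exact absurd (hI0 L) (not_lt.2 this)
    rw [lt_div_iff₀ hΛ0] at hL
    have hTlow : c' * (I L).card ≤ T.card := by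
      calc c' * (I L).card ≤ c' * ((C + 1) * Λ.card) := by
            gcongr
            exact (hC L).trans (by gcongr; linarith)
        _ = c / 2 * Λ.card := by rw [hc']; field_simp
        _ ≤ T.card := hL.le
    have hTup : (T.card : ℝ) ≤ F.card * (I L).card :=
      (Nat.cast_le.2 (card_le_of_subset_sitesIn (S ω) Λ T)).trans hΛI
    have hmain := hcount s ε hs0 L ω T fun i hi => by
      have hi := (Finset.mem_filter.1 hi).2
      rw [abs_le]
      constructor <;> linarith [hi.1, hi.2]
    have hbad' : ((core Q (I L)).filter fun g => ¬ IsCoerciveOn hfin (shift g ω)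
          (S (shift g ω)) E (exhaustion F I m) s).card = bad := by
      rw [hbad]
      congr 1
    rw [hbad', ← hD] at hmain
    exact frequency_lower_bound (Nat.cast_nonneg _) (Nat.cast_nonneg _) (Nat.cast_nonneg _)
      hs0 hc'0 hδ hε2 (by exact_mod_cast (hI.nonempty m).card_pos) (hI0 L).le
      hTlow hTup hcore hBI hDm hmain
  have hle := le_measure_of_eventually_le_card hP
    (A := {ω | ¬ IsCoerciveOn hfin ω (S ω) E (exhaustion F I m) s})
    (measurableSet_isCoerciveOn hfin hS E (exhaustion F I m) s).compl hI.nonempty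
    (fun L => core_subset Q (I L)) hfreq
  have := (hle.trans_lt hs)
  rw [ENNReal.ofReal_lt_ofReal_iff hδ0] at this
  linarith

end IDS

end QuantumPercolation

open QuantumPercolation
theorem proposition5p2 {V Γ : Type*} (G : SimpleGraph V) (hconn : G.Connected)
    (hlf : ∀ v, (G.neighborSet v).Finite)
    [Group Γ] [MulAction Γ V]
    (hadj : ∀ (γ : Γ) (u v : V), G.Adj (γ • u) (γ • v) ↔ G.Adj u v)
    (hstab : ∀ v : V, Finite (MulAction.stabilizer Γ v))
    (F : Finset V) (hF : ∀ v : V, ∃ γ : Γ, γ • v ∈ F)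
    (I : ℕ → Finset Γ) (hI : IsFolnerSequence I)
    (P : Measure (V → ℝ≥0∞)) [IsProbabilityMeasure P] (hP : IsErgodicField Γ P)
    (R : ℕ) (H : HoppingOperator G Γ R) (E : ℝ) :
    ((¬ UniqueContinuation G R H.kernel P activeSites E ↔
          E ∈ almostSureSigmaFin H.kernel P activeSites) ∧
      ∀ N : ℝ → ℝ, IsIDS H.symm P activeSites (exhaustion F I) N →
        (¬ ContinuousAt N E ↔ ¬ UniqueContinuation G R H.kernel P activeSites E)) ∧
    ((¬ UniqueContinuation G R H.kernel P (infiniteCluster H.kernel) E ↔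
          E ∈ almostSureSigmaFin H.kernel P (infiniteCluster H.kernel)) ∧
      ∀ N : ℝ → ℝ, IsIDS H.symm P (infiniteCluster H.kernel) (exhaustion F I) N →
        (¬ ContinuousAt N E ↔
          ¬ UniqueContinuation G R H.kernel P (infiniteCluster H.kernel) E)) := by
  have : Countable V := countable_of_connected G hconn hlf
  have : Nonempty V := hconn.nonempty
  -- Only measurability and equivariance of the random site set matter, so both families are
  -- instances of one argument.
  have main : ∀ S : (V → ℝ≥0∞) → Set V, IsSiteField Γ S →
      (¬ UniqueContinuation G R H.kernel P S E ↔ E ∈ almostSureSigmaFin H.kernel P S) ∧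
      ∀ N : ℝ → ℝ, IsIDS H.symm P S (exhaustion F I) N →
        (¬ ContinuousAt N E ↔ ¬ UniqueContinuation G R H.kernel P S E) := by
    intro S hS
    have hfin := H.finite_row hconn hlf
    have hiff := not_uniqueContinuation_iff hconn H.symm hfin H.range H.invariant hS hP E
    refine ⟨hiff, fun N hN => ?_⟩
    rw [hiff]
    exact ⟨mem_almostSureSigmaFin_of_not_continuousAt H.symm hfin H.invariant hS hstab hF hI hP hN,
      fun hE hcont => not_mem_almostSureSigmaFin_of_continuousAt H.symm hfin H.invariant hS hstab
        hF hI hP hN hcont hE⟩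
  exact ⟨main _ (isSiteField_activeSites Γ), main _ (isSiteField_infiniteCluster H.invariant)⟩
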